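/- An instance of Binary Partial Coding consists of a number $d \ge 0$ of binary attributes and a finite family of symbols $s_1,\dots,s_n \subseteq \{1,\dots,d\}$ (repetitions allowed). It is feasible if there are encodings $c_j : s_j \to \{0,1\}$, $j = 1,\dots,n$, such that for all $j \ne k$ there is an attribute $i \in s_j \cap s_k$ with $c_j(i) \ne c_k(i)$. It is given as a string by writing $d$ in unary, followed by the $n \times d$ incidence matrix of symbols and attributes. An instance of one-machine Windows Scheduling with unit-length jobs and exact periods consists of positive integers $p_1,\dots,p_m$, given in binary. It is schedulable if the time slots $0,1,2,\dots$ can be assigned to the jobs, each slot to at most one job, so that every job $j$ is executed in one of the first $p_j$ slots and the distance between any execution of $j$ and the next one is exactly $p_j$. Theorem. There are a function $R$ from instances of Binary Partial Coding to instances of one-machine Windows Scheduling with unit-length jobs and exact periods, computable by a (multi-tape) Turing machine in time polynomial in the length of the input string, and a constant $C$, such that 1. an instance $I$ of Binary Partial Coding is feasible if and only if $R(I)$ is schedulable, and 2. for every instance $I$ with $d$ attributes, every period of $R(I)$ is at most $\max(2,d)^{C d}$; in particular, the maximum period is $d^{O(d)}$. -/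

import Mathlib

/-- An instance of Partial Coding: `d` attributes, attribute `i` having the value range
`{0, …, f i - 1}` with `f i ≥ 2`, and a finite family of symbols, each symbol being a set of
attributes. A family may contain the same set several times. -/
structure PCInstance where
  d : ℕ
  f : Fin d → ℕ
  two_le_f : ∀ i, 2 ≤ f i
  symbols : List (Finset (Fin d))

/-- Some encodings `c j : s_j → ℕ` of the symbols, with `c j i ∈ [0, f i - 1]`, distinguish any two
symbols (with distinct indices) by an attribute that the two have in common. -/
def PCInstance.Feasible (I : PCInstance) : Prop :=
  ∃ c : (j : Fin I.symbols.length) → {i : Fin I.d // i ∈ I.symbols.get j} → ℕ,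
    (∀ j i, c j i < I.f i.1) ∧
    ∀ j k, j ≠ k → ∃ (i : Fin I.d) (hj : i ∈ I.symbols.get j) (hk : i ∈ I.symbols.get k),
      c j ⟨i, hj⟩ ≠ c k ⟨i, hk⟩

/-- An instance of Binary Partial Coding: `d` binary attributes and a family of symbols. -/
structure BPCInstance where
  d : ℕ
  symbols : List (Finset (Fin d))

/-- Binary Partial Coding is Partial Coding with all value ranges equal to `{0, 1}`. -/
def BPCInstance.toPC (I : BPCInstance) : PCInstance where
  d := I.d
  f := fun _ => 2
  two_le_f := fun _ => le_rfl
  symbols := I.symbols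

/-- The incidence row of a symbol: `d` bits. -/
def symbolBits {d : ℕ} (s : Finset (Fin d)) : List Bool :=
  List.ofFn fun i => decide (i ∈ s)

/-- The input string of an instance: `d` in unary, followed by the 0-1 incidence matrix of symbols
and attributes, symbol by symbol. Here `some b` is a bit and `none` is the end marker of a block. -/
def BPCInstance.encode (I : BPCInstance) : List (Option Bool) :=
  List.replicate I.d (some true) ++ none ::
    I.symbols.flatMap fun s => (symbolBits s).map some ++ [none]

/-- An instance of Windows Scheduling with one machine, unit-length jobs and exact periods:
the list of the periods of the jobs. -/
structure WSInstance where
  periods : List ℕ+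

/-- The string of an instance: the periods in binary, each followed by an end marker. -/
def WSInstance.encode (W : WSInstance) : List (Option Bool) :=
  W.periods.flatMap fun p : ℕ+ => (Computability.encodeNat (p : ℕ)).map some ++ [none]

/-- A one-machine schedule for unit-length jobs says for each time slot `t = 0, 1, 2, …` which job,
if any, the machine executes. It is feasible for exact periods if every job `j` is executed within
the first `p_j` slots, and the distance between any execution of `j` and the next one is
exactly `p_j`. -/
def WSInstance.IsSchedule (W : WSInstance) (σ : ℕ → Option (Fin W.periods.length)) : Prop :=
  ∀ j : Fin W.periods.length,
    (∃ t, t < (W.periods.get j : ℕ) ∧ σ t = some j) ∧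
    ∀ t, σ t = some j →
      σ (t + (W.periods.get j : ℕ)) = some j ∧
      ∀ s, t < s → s < t + (W.periods.get j : ℕ) → σ s ≠ some j

def WSInstance.Schedulable (W : WSInstance) : Prop :=
  ∃ σ, W.IsSchedule σ

/-- Blocks of bits that are each closed by an end marker can be read back. -/
theorem flatMap_blocks_injective {α : Type*} (g : α → List Bool) (hg : Function.Injective g) :
    Function.Injective
      (fun l : List α => l.flatMap fun a => (g a).map some ++ [(none : Option Bool)]) := by
  have key : ∀ (u v : List Bool) (x y : List (Option Bool)),
      u.map some ++ none :: x = v.map some ++ none :: y → u = v ∧ x = y := by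
    intro u
    induction u with
    | nil => intro v x y h; cases v <;> simp_all
    | cons b u ih =>
      intro v x y h
      cases v with
      | nil => simp at h
      | cons c v =>
        simp only [List.map_cons, List.cons_append, List.cons.injEq, Option.some.injEq] at h
        obtain ⟨h1, h2⟩ := ih v x y h.2
        exact ⟨by rw [h.1, h1], h2⟩
  intro l
  induction l with
  | nil => intro m h; cases m <;> simp_all
  | cons a l ih =>
    intro m h
    cases m with
    | nil => simp at h
    | cons b m =>
      simp only [List.flatMap_cons, List.append_assoc, List.singleton_append] at h
      obtain ⟨h1, h2⟩ := key _ _ _ _ h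
      rw [hg h1, ih h2]

/-- Distinct scheduling instances have distinct encodings. -/
theorem WSInstance.encode_injective : Function.Injective WSInstance.encode := by
  rintro ⟨l⟩ ⟨m⟩ h
  have hinj : Function.Injective (fun p : ℕ+ => Computability.encodeNat (p : ℕ)) := by
    intro p q hpq
    have := congrArg Computability.decodeNat hpq
    simpa [Computability.decode_encodeNat] using this
  simp only [WSInstance.encode] at h
  have : l = m := flatMap_blocks_injective _ hinj h
  rw [this]

/-- Distinct coding instances have distinct encodings. -/
theorem BPCInstance.encode_injective : Function.Injective BPCInstance.encode := by
  rintro ⟨d, l⟩ ⟨e, m⟩ h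
  simp only [BPCInstance.encode] at h
  have key : ∀ (d e : ℕ) (x y : List (Option Bool)),
      List.replicate d (some true) ++ none :: x = List.replicate e (some true) ++ none :: y →
        d = e ∧ x = y := by
    intro d
    induction d with
    | zero => intro e x y h; cases e <;> simp_all [List.replicate_succ]
    | succ d ih =>
      intro e x y h
      cases e with
      | zero => simp [List.replicate_succ] at h
      | succ e =>
        simp only [List.replicate_succ, List.cons_append, List.cons.injEq, true_and] at h
        obtain ⟨h1, h2⟩ := ih e x y h
        exact ⟨by rw [h1], h2⟩
  obtain ⟨rfl, h2⟩ := key _ _ _ _ h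
  have := flatMap_blocks_injective (symbolBits (d := d))
    (fun s t hst => by
      have := List.ofFn_injective hst
      ext i
      simpa using congrFun this i) h2
  rw [this]

/-! A schedule with exact periods amounts to one residue per job, such that any two jobs differ
modulo the gcd of their periods. If the periods are products of pairwise coprime moduli, the Chinese
remainder theorem splits a residue into coordinates, one for each modulus of the job, and any two
jobs must differ in a common coordinate (`WSInstance.schedulable_iff`). This is Partial Coding with
large value ranges; the task is to force the ranges down to two values.

Give each attribute `i` two primes `p < q` above `d + 1`, all `2 * d` of them distinct. The period
of a symbol is `d + 1`, times `q ^ 2` for each attribute that it has, times `p` for each one that it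
lacks. Add `d` empty symbols and, for each `i`, `(q ^ 2 - 2) * (p - 1)` fillers of period `d * p * q
^ 2`. Given binary codes, the symbols use the residues 0 and 1 modulo `q ^ 2` and 0 modulo `p`, and
the fillers use all the pairs of remaining residues.

Conversely, fillers of different attributes share only the modulus `d`. The `d` attributes therefore
exhaust the residues modulo `d`, and the fillers of one attribute agree there; they have to differ
modulo `p` or `q ^ 2`. A symbol shares exactly one of these two moduli with a filler of `i`, so the
fillers avoid all residues that symbols use. If the symbols use `a` residues modulo `q ^ 2` and `b`
modulo `p`, where `b ≥ 1` because of the empty symbols, then `(q ^ 2 - 2) * (p - 1) ≤ (q ^ 2 - a) *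
(p - b)`. As `q ^ 2 > 2 * p`, this yields `a ≤ 2` and `b ≤ 1` (`le_of_rectangle`). Hence an absent
attribute distinguishes no symbols, the empty symbols need `d` separate residues modulo `d + 1`, and
the original symbols all share the last one. They must then differ at a common attribute, where only
two residues occur.

A Chebyshev estimate bounds the primes by `(d + 1) ^ 8` (`lastPrime_le`), so there are polynomially
many fillers and all periods are `d ^ O(d)`. For the running time, the reduction is written in a
small language whose loops run exactly as often as the input has symbols. Its programs compile to
stack machines that run in polynomial time (`Cmd.runsIn_code`, `Cmd.polyTime`), and
`Cmd.exec_reduction` verifies the program. -/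

open Turing

/-! ### Memory states. -/

/-- The counters of the reduction program. -/
inductive Reg
  | d | c | t | e | z | y | f | g | k | h | o | w | a | x | b | u
  deriving DecidableEq

instance : Fintype Reg where
  elems := {.d, .c, .t, .e, .z, .y, .f, .g, .k, .h, .o, .w, .a, .x, .b, .u}
  complete r := by cases r <;> decide

/-- The string registers of the reduction program. -/
inductive Str
  | inp | out | bin | tmp
  deriving DecidableEq

instance : Fintype Str where
  elems := {.inp, .out, .bin, .tmp}
  complete r := by cases r <;> decide

/-- A memory state: the values of the counters and of the string registers. -/
structure Mem where
  d : ℕ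
  c : ℕ
  t : ℕ
  e : ℕ
  z : ℕ
  y : ℕ
  f : ℕ
  g : ℕ
  k : ℕ
  h : ℕ
  o : ℕ
  w : ℕ
  a : ℕ
  x : ℕ
  b : ℕ
  u : ℕ
  inp : List (Option Bool)
  out : List (Option Bool)
  bin : List (Option Bool)
  tmp : List (Option Bool)

namespace Mem

/-- The value of a counter. -/
def get (s : Mem) : Reg → ℕ
  | .d => s.d
  | .c => s.c
  | .t => s.t
  | .e => s.e
  | .z => s.z
  | .y => s.y
  | .f => s.f
  | .g => s.g
  | .k => s.k
  | .h => s.h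
  | .o => s.o
  | .w => s.w
  | .a => s.a
  | .x => s.x
  | .b => s.b
  | .u => s.u

/-- Overwrite a counter. -/
def set (s : Mem) (r : Reg) (v : ℕ) : Mem :=
  match r with
  | .d => { s with d := v }
  | .c => { s with c := v }
  | .t => { s with t := v }
  | .e => { s with e := v }
  | .z => { s with z := v }
  | .y => { s with y := v }
  | .f => { s with f := v }
  | .g => { s with g := v }
  | .k => { s with k := v }
  | .h => { s with h := v }
  | .o => { s with o := v }
  | .w => { s with w := v }
  | .a => { s with a := v }
  | .x => { s with x := v }
  | .b => { s with b := v }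
  | .u => { s with u := v }

/-- The value of a string register. -/
def gets (s : Mem) : Str → List (Option Bool)
  | .inp => s.inp
  | .out => s.out
  | .bin => s.bin
  | .tmp => s.tmp

/-- Overwrite a string register. -/
def sets (s : Mem) (k : Str) (v : List (Option Bool)) : Mem :=
  match k with
  | .inp => { s with inp := v }
  | .out => { s with out := v }
  | .bin => { s with bin := v }
  | .tmp => { s with tmp := v }

theorem get_set (s : Mem) (r r' : Reg) (v : ℕ) :
    (s.set r v).get r' = if r' = r then v else s.get r' := by
  cases r <;> cases r' <;> rfl

theorem gets_set (s : Mem) (r : Reg) (k : Str) (v : ℕ) : (s.set r v).gets k = s.gets k := by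
  cases r <;> cases k <;> rfl

theorem get_sets (s : Mem) (r : Reg) (k : Str) (v : List (Option Bool)) :
    (s.sets k v).get r = s.get r := by
  cases r <;> cases k <;> rfl

theorem gets_sets (s : Mem) (k k' : Str) (v : List (Option Bool)) :
    (s.sets k v).gets k' = if k' = k then v else s.gets k' := by
  cases k <;> cases k' <;> rfl

theorem set_set (s : Mem) (r : Reg) (v v' : ℕ) : (s.set r v).set r v' = s.set r v' := by
  cases r <;> rfl

theorem set_comm (s : Mem) {r r' : Reg} (h : r ≠ r') (v v' : ℕ) :
    (s.set r v).set r' v' = (s.set r' v').set r v := by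
  cases r <;> cases r' <;> first | rfl | exact absurd rfl h

theorem sets_set (s : Mem) (r : Reg) (k : Str) (v : ℕ) (v' : List (Option Bool)) :
    (s.set r v).sets k v' = (s.sets k v').set r v := by
  cases r <;> cases k <;> rfl

theorem set_get (s : Mem) (r : Reg) : s.set r (s.get r) = s := by
  cases r <;> rfl

/-- The memory with zero counters and given input and output strings. -/
def blank (x y : List (Option Bool)) : Mem where
  d := 0
  c := 0
  t := 0
  e := 0
  z := 0
  y := 0
  f := 0
  g := 0
  k := 0
  h := 0
  o := 0
  w := 0
  a := 0
  x := 0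
  b := 0
  u := 0
  inp := x
  out := y
  bin := []
  tmp := []

end Mem

/-! ### Loop programs and their compilation to stack machines. -/

/-- Programs with counters, strings and loops that run a fixed number of times. -/
inductive Cmd
  | skip
  | inc (r : Reg)
  | dec (r : Reg)
  | push (k : Str) (a : Option Bool)
  | pop (k : Str)
  | seq (P Q : Cmd)
  | ifz (r : Reg) (P Q : Cmd)
  | ifs (k : Str) (p : Option (Option Bool) → Bool) (P Q : Cmd)
  | rep (P : Cmd)

namespace Cmd

/-- The effect of a program, every loop being run `N` times. -/
def exec (N : ℕ) : Cmd → Mem → Mem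
  | skip, s => s
  | inc r, s => s.set r (s.get r + 1)
  | dec r, s => s.set r (s.get r - 1)
  | push k a, s => s.sets k (a :: s.gets k)
  | pop k, s => s.sets k (s.gets k).tail
  | seq P Q, s => exec N Q (exec N P s)
  | ifz r P Q, s => bif s.get r == 0 then exec N P s else exec N Q s
  | ifs k p P Q, s => bif p (s.gets k).head? then exec N P s else exec N Q s
  | rep P, s => (exec N P)^[N] s

/-- The program points of a program. -/
def Lab : Cmd → Type
  | seq P Q => Lab P ⊕ Lab Q
  | ifz _ P Q => Option (Lab P ⊕ Lab Q)
  | ifs _ _ P Q => Option (Lab P ⊕ Lab Q)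
  | rep P => Option (Option (Lab P))
  | _ => Unit

instance finiteLab : ∀ P : Cmd, Finite (Lab P)
  | skip | inc _ | dec _ | push _ _ | pop _ => inferInstanceAs (Finite Unit)
  | seq P Q => by
      have := finiteLab P; have := finiteLab Q
      exact inferInstanceAs (Finite (Lab P ⊕ Lab Q))
  | ifz _ P Q | ifs _ _ P Q => by
      have := finiteLab P; have := finiteLab Q
      exact inferInstanceAs (Finite (Option (Lab P ⊕ Lab Q)))
  | rep P => by
      have := finiteLab P
      exact inferInstanceAs (Finite (Option (Option (Lab P))))

/-- The first program point. -/
def entry : (P : Cmd) → Lab P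
  | seq P _ => Sum.inl (entry P)
  | ifz _ _ _ | ifs _ _ _ _ | rep _ => (none : Option _)
  | skip | inc _ | dec _ | push _ _ | pop _ => ()

/-- The stacks of the machine: the registers, and two stacks for each program point, which count
the iterations of the loop at this point that are still to come and those already done. -/
abbrev Stack (L : Type) := Reg ⊕ Str ⊕ L × Bool

/-- Statements of the machine. All stacks have the alphabet of the strings, and the internal state
holds a symbol that was read. -/
abbrev MStmt (L : Type) :=
  TM2.Stmt (K := Stack L) (fun _ => Option Bool) L (Option (Option Bool))

/-- Read the top symbol of a stack and branch. -/
def test {L : Type} (k : Stack L) (p : Option (Option Bool) → Bool) (l l' : L) : MStmt L :=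
  .peek k (fun _ v => v) (.branch p (.load (fun _ => none) (.goto fun _ => l))
    (.load (fun _ => none) (.goto fun _ => l')))

/-- Move one symbol from a stack to another one, or go to `l'` if there is none. -/
def shift {L : Type} (k k' : Stack L) (l l' : L) : MStmt L :=
  .pop k (fun _ v => v) (.branch Option.isSome
    (.push k' (fun v => v.getD none) (.load (fun _ => none) (.goto fun _ => l)))
    (.load (fun _ => none) (.goto fun _ => l')))

/-- The statements of a program, its program points being embedded into a larger set of labels. -/
def code {L : Type} : (P : Cmd) → (Lab P → L) → L → Lab P → MStmt L
  | skip, _, ex, _ => .goto fun _ => ex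
  | inc r, _, ex, _ => .push (.inl r) (fun _ => none) (.goto fun _ => ex)
  | dec r, _, ex, _ => .pop (.inl r) (fun v _ => v) (.goto fun _ => ex)
  | push k a, _, ex, _ => .push (.inr (.inl k)) (fun _ => a) (.goto fun _ => ex)
  | pop k, _, ex, _ => .pop (.inr (.inl k)) (fun v _ => v) (.goto fun _ => ex)
  | seq P Q, em, ex, l =>
    match (l : Lab P ⊕ Lab Q) with
    | .inl l => code P (fun l => em (Sum.inl l : Lab P ⊕ Lab Q))
        (em (Sum.inr (entry Q) : Lab P ⊕ Lab Q)) l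
    | .inr l => code Q (fun l => em (Sum.inr l : Lab P ⊕ Lab Q)) ex l
  | ifz r P Q, em, ex, l =>
    match (l : Option (Lab P ⊕ Lab Q)) with
    | none => test (.inl r) Option.isNone (em (some (.inl (entry P)) : Option (Lab P ⊕ Lab Q)))
        (em (some (.inr (entry Q)) : Option (Lab P ⊕ Lab Q)))
    | some (.inl l) => code P (fun l => em (some (.inl l) : Option (Lab P ⊕ Lab Q))) ex l
    | some (.inr l) => code Q (fun l => em (some (.inr l) : Option (Lab P ⊕ Lab Q))) ex l
  | ifs k p P Q, em, ex, l =>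
    match (l : Option (Lab P ⊕ Lab Q)) with
    | none => test (.inr (.inl k)) p (em (some (.inl (entry P)) : Option (Lab P ⊕ Lab Q)))
        (em (some (.inr (entry Q)) : Option (Lab P ⊕ Lab Q)))
    | some (.inl l) => code P (fun l => em (some (.inl l) : Option (Lab P ⊕ Lab Q))) ex l
    | some (.inr l) => code Q (fun l => em (some (.inr l) : Option (Lab P ⊕ Lab Q))) ex l
  | rep P, em, ex, l =>
    let hd : L := em (none : Option (Option (Lab P)))
    let back : L := em (some none : Option (Option (Lab P)))
    match (l : Option (Option (Lab P))) with
    | none => shift (.inr (.inr (hd, false))) (.inr (.inr (hd, true)))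
        (em (some (some (entry P)) : Option (Option (Lab P)))) back
    | some none => shift (.inr (.inr (hd, true))) (.inr (.inr (hd, false))) back ex
    | some (some l) => code P (fun l => em (some (some l) : Option (Option (Lab P)))) hd l

/-- A bound for the running time. -/
noncomputable def time : Cmd → Polynomial ℕ
  | seq P Q => time P + time Q
  | ifz _ P Q | ifs _ _ P Q => 1 + time P + time Q
  | rep P => .X * (time P + 2) + 2
  | _ => 1

end Cmd

/-- The contents of the stacks that represent a memory state and loop counters. -/
def Mem.stk {L : Type} (s : Mem) (F : L × Bool → ℕ) : Cmd.Stack L → List (Option Bool)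
  | .inl r => List.replicate (s.get r) none
  | .inr (.inl k) => s.gets k
  | .inr (.inr i) => List.replicate (F i) none

namespace Mem

variable {L : Type} [DecidableEq L] (s : Mem) (F : L × Bool → ℕ)

theorem update_stk_reg (r : Reg) (v : ℕ) :
    Function.update (s.stk F) (.inl r) (List.replicate v none) = (s.set r v).stk F := by
  funext k
  rcases k with i | i | i
  · by_cases h : i = r
    · subst h; simp [stk, get_set]
    · simp [stk, get_set, h]
  · simp [stk, gets_set]
  · simp [stk]

theorem update_stk_str (k : Str) (v : List (Option Bool)) :
    Function.update (s.stk F) (.inr (.inl k)) v = (s.sets k v).stk F := by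
  funext r
  rcases r with r | r | r
  · simp [stk, get_sets]
  · by_cases h : r = k
    · subst h; simp [stk, gets_sets]
    · simp [stk, gets_sets, h]
  · simp [stk]

theorem update_stk_loop (i : L × Bool) (n : ℕ) :
    Function.update (s.stk F) (.inr (.inr i)) (List.replicate n none) =
      s.stk (Function.update F i n) := by
  funext r
  rcases r with r | r | r
  · simp [stk]
  · simp [stk]
  · by_cases h : r = i
    · subst h; simp [stk]
    · simp [stk, h]

end Mem

/-! ### Correctness and running time of the compiled code. -/

/-- A configuration leads to another one in at most `n` steps. -/
def RunsIn {L : Type} [DecidableEq L] (M : L → Cmd.MStmt L) (n : ℕ)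
    (c c' : TM2.Cfg (K := Cmd.Stack L) (fun _ => Option Bool) L (Option (Option Bool))) : Prop :=
  ∃ m ≤ n, (flip bind (TM2.step M))^[m] (some c) = some c'

namespace RunsIn

variable {L : Type} [DecidableEq L] {M : L → Cmd.MStmt L}
  {c c' c'' : TM2.Cfg (K := Cmd.Stack L) (fun _ => Option Bool) L (Option (Option Bool))}

theorem mono {m n : ℕ} (h : RunsIn M m c c') (hmn : m ≤ n) : RunsIn M n c c' := by
  obtain ⟨k, hk, e⟩ := h
  exact ⟨k, hk.trans hmn, e⟩

theorem trans {m n : ℕ} (h : RunsIn M m c c') (h' : RunsIn M n c' c'') :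
    RunsIn M (m + n) c c'' := by
  obtain ⟨k, hk, e⟩ := h
  obtain ⟨k', hk', e'⟩ := h'
  exact ⟨k' + k, by omega, by rw [Function.iterate_add_apply, e, e']⟩

theorem single {l : L} {S : Cmd.Stack L → List (Option Bool)} {v}
    (h : TM2.stepAux (M l) v S = c') : RunsIn M 1 ⟨some l, v, S⟩ c' := by
  refine ⟨1, le_rfl, ?_⟩
  rw [Function.iterate_one, ← h]
  rfl

end RunsIn

namespace Cmd

variable {L : Type} [DecidableEq L]

theorem stepAux_test (k : Stack L) (p : Option (Option Bool) → Bool) (l l' : L)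
    (S : Stack L → List (Option Bool)) :
    TM2.stepAux (test k p l l') none S = ⟨some (if p (S k).head? then l else l'), none, S⟩ := by
  simp only [test, TM2.stepAux]
  cases p (S k).head? <;> rfl

theorem stepAux_shift (k k' : Stack L) (l l' : L) (S : Stack L → List (Option Bool)) :
    (∀ a v, S k = a :: v → TM2.stepAux (shift k k' l l') none S =
      ⟨some l, none, Function.update (Function.update S k v) k'
        (a :: Function.update S k v k')⟩) ∧
    (S k = [] → TM2.stepAux (shift k k' l l') none S = ⟨some l', none, S⟩) := by
  constructor
  · intro a v h
    simp [shift, h]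
  · intro h
    simp only [shift, TM2.stepAux, h, List.head?_nil, Option.isSome_none, cond_false, List.tail_nil]
    rw [← h, Function.update_eq_self]

theorem replicate_tail {α : Type*} (n : ℕ) (a : α) :
    (List.replicate n a).tail = List.replicate (n - 1) a := by
  cases n <;> simp [List.replicate_succ]

/-- Covers both directions of token transfer: `b = false` counts a round as done at the loop head,
`b = true` returns a token afterwards. The label `lab` is separate from `hd` because the returning
phase has its own program point but uses the stacks of the head. -/
theorem runsIn_shift_loop {M : L → MStmt L} {hd l l' : L} {b : Bool} (s : Mem)
    (F : L × Bool → ℕ) {lab : L}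
    (hM : M lab = shift (.inr (.inr (hd, b))) (.inr (.inr (hd, !b))) l l') (n m : ℕ) :
    RunsIn M 1 ⟨some lab, none, s.stk (Function.update (Function.update F (hd, b) (n + 1))
        (hd, !b) m)⟩
      ⟨some l, none, s.stk (Function.update (Function.update F (hd, b) n) (hd, !b) (m + 1))⟩ ∧
    RunsIn M 1 ⟨some lab, none, s.stk (Function.update (Function.update F (hd, b) 0)
        (hd, !b) m)⟩
      ⟨some l', none, s.stk (Function.update (Function.update F (hd, b) 0) (hd, !b) m)⟩ := by
  have hne : ((hd, b) : L × Bool) ≠ (hd, !b) := by cases b <;> simp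
  constructor
  · apply RunsIn.single
    rw [hM, (stepAux_shift _ _ _ _ _).1 none (List.replicate n none)
      (by simp [Mem.stk, List.replicate_succ])]
    rw [Mem.update_stk_loop]
    have : ∀ F : L × Bool → ℕ, (none : Option Bool) :: s.stk F (.inr (.inr (hd, !b))) =
        List.replicate (F (hd, !b) + 1) none := fun F => by simp [Mem.stk, List.replicate_succ]
    rw [this, Mem.update_stk_loop]
    congr 2
    funext i
    by_cases h1 : i = (hd, b)
    · subst h1; simp
    · by_cases h2 : i = (hd, !b)
      · subst h2; simp
      · simp [Function.update_of_ne h1, Function.update_of_ne h2]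
  · apply RunsIn.single
    rw [hM, (stepAux_shift _ _ _ _ _).2 (by simp [Mem.stk])]

/-- The machine follows the program. -/
theorem runsIn_code (N : ℕ) (M : L → MStmt L) : ∀ (P : Cmd) (em : Lab P → L) (ex : L) (s : Mem)
    (F : L × Bool → ℕ), Function.Injective em → (∀ l, M (em l) = code P em ex l) →
    (∀ l, F (em l, false) = N ∧ F (em l, true) = 0) →
    RunsIn M (P.time.eval N) ⟨some (em (entry P)), none, s.stk F⟩
      ⟨some ex, none, (P.exec N s).stk F⟩ := by
  intro P
  induction P with
  | skip =>
    intro em ex s F _ hM _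
    simp only [time, Polynomial.eval_one]
    exact RunsIn.single (by rw [hM]; simp [code, exec])
  | inc r =>
    intro em ex s F _ hM _
    simp only [time, Polynomial.eval_one]
    refine RunsIn.single ?_
    rw [hM]
    simp only [code, TM2.stepAux, exec]
    rw [← Mem.update_stk_reg]
    rfl
  | dec r =>
    intro em ex s F _ hM _
    simp only [time, Polynomial.eval_one]
    refine RunsIn.single ?_
    rw [hM]
    simp only [code, TM2.stepAux, exec]
    rw [← Mem.update_stk_reg, ← replicate_tail]
    rfl
  | push k a =>
    intro em ex s F _ hM _
    simp only [time, Polynomial.eval_one]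
    refine RunsIn.single ?_
    rw [hM]
    simp only [code, TM2.stepAux, exec]
    rw [← Mem.update_stk_str]
    rfl
  | pop k =>
    intro em ex s F _ hM _
    simp only [time, Polynomial.eval_one]
    refine RunsIn.single ?_
    rw [hM]
    simp only [code, TM2.stepAux, exec]
    rw [← Mem.update_stk_str]
    rfl
  | seq P Q ihP ihQ =>
    intro em ex s F hi hM hF
    simp only [time, Polynomial.eval_add]
    refine RunsIn.trans (ihP (fun l => em (Sum.inl l : Lab P ⊕ Lab Q))
      (em (Sum.inr (entry Q) : Lab P ⊕ Lab Q)) s F ?_ ?_ ?_)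
      (ihQ (fun l => em (Sum.inr l : Lab P ⊕ Lab Q)) ex (exec N P s) F ?_ ?_ ?_)
    · exact hi.comp Sum.inl_injective
    · exact fun l => hM (Sum.inl l : Lab P ⊕ Lab Q)
    · exact fun l => hF _
    · exact hi.comp Sum.inr_injective
    · exact fun l => hM (Sum.inr l : Lab P ⊕ Lab Q)
    · exact fun l => hF _
  | ifz r P Q ihP ihQ =>
    intro em ex s F hi hM hF
    simp only [time, Polynomial.eval_add, Polynomial.eval_one]
    have h1 : RunsIn M 1 ⟨some (em (entry (ifz r P Q))), none, s.stk F⟩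
        ⟨some (if Option.isNone (s.stk F (.inl r)).head?
          then em (some (.inl (entry P)) : Option (Lab P ⊕ Lab Q))
          else em (some (.inr (entry Q)) : Option (Lab P ⊕ Lab Q))), none, s.stk F⟩ :=
      RunsIn.single (by rw [hM]; exact stepAux_test _ _ _ _ _)
    have h0 : (Option.isNone (s.stk F (.inl r)).head?) = decide (s.get r = 0) := by
      simp only [Mem.stk]
      cases s.get r <;> simp [List.replicate_succ]
    rw [h0] at h1
    by_cases h : s.get r = 0
    · simp only [h, decide_true, if_true, exec, beq_self_eq_true, cond_true] at h1 ⊢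
      refine (h1.trans (ihP (fun l => em (some (.inl l) : Option (Lab P ⊕ Lab Q))) ex s F
        (hi.comp ((Option.some_injective _).comp Sum.inl_injective))
        (fun l => hM (some (.inl l) : Option (Lab P ⊕ Lab Q))) (fun l => hF _))).mono ?_
      omega
    · simp only [h, decide_false, exec, beq_eq_false_iff_ne.2 h, cond_false] at h1 ⊢
      refine (h1.trans (ihQ (fun l => em (some (.inr l) : Option (Lab P ⊕ Lab Q))) ex s F
        (hi.comp ((Option.some_injective _).comp Sum.inr_injective))
        (fun l => hM (some (.inr l) : Option (Lab P ⊕ Lab Q))) (fun l => hF _))).mono ?_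
      omega
  | ifs k p P Q ihP ihQ =>
    intro em ex s F hi hM hF
    simp only [time, Polynomial.eval_add, Polynomial.eval_one]
    have h1 : RunsIn M 1 ⟨some (em (entry (ifs k p P Q))), none, s.stk F⟩
        ⟨some (if p (s.stk F (.inr (.inl k))).head?
          then em (some (.inl (entry P)) : Option (Lab P ⊕ Lab Q))
          else em (some (.inr (entry Q)) : Option (Lab P ⊕ Lab Q))), none, s.stk F⟩ :=
      RunsIn.single (by rw [hM]; exact stepAux_test _ _ _ _ _)
    have h0 : s.stk F (.inr (.inl k)) = s.gets k := rfl
    rw [h0] at h1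
    by_cases h : p (s.gets k).head? = true
    · simp only [h, if_true, exec, cond_true] at h1 ⊢
      refine (h1.trans (ihP (fun l => em (some (.inl l) : Option (Lab P ⊕ Lab Q))) ex s F
        (hi.comp ((Option.some_injective _).comp Sum.inl_injective))
        (fun l => hM (some (.inl l) : Option (Lab P ⊕ Lab Q))) (fun l => hF _))).mono ?_
      omega
    · rw [Bool.not_eq_true] at h
      simp only [h, exec, cond_false] at h1 ⊢
      refine (h1.trans (ihQ (fun l => em (some (.inr l) : Option (Lab P ⊕ Lab Q))) ex s F
        (hi.comp ((Option.some_injective _).comp Sum.inr_injective))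
        (fun l => hM (some (.inr l) : Option (Lab P ⊕ Lab Q))) (fun l => hF _))).mono ?_
      omega
  | rep P ih =>
    intro em ex s F hi hM hF
    set hd : L := em (none : Option (Option (Lab P))) with hhd
    set back : L := em (some none : Option (Option (Lab P))) with hback
    have hMhd : M hd = shift (.inr (.inr (hd, false))) (.inr (.inr (hd, !false)))
        (em (some (some (entry P)) : Option (Option (Lab P)))) back := hM none
    have hMback : M back = shift (.inr (.inr (hd, true))) (.inr (.inr (hd, !true))) back ex :=
      hM (some none : Option (Option (Lab P)))
    have body : ∀ (s : Mem) (n m : ℕ), RunsIn M (P.time.eval N)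
        ⟨some (em (some (some (entry P)) : Option (Option (Lab P)))), none,
          s.stk (Function.update (Function.update F (hd, false) n) (hd, !false) m)⟩
        ⟨some hd, none, (P.exec N s).stk
          (Function.update (Function.update F (hd, false) n) (hd, !false) m)⟩ := by
      intro s n m
      refine ih (fun l => em (some (some l) : Option (Option (Lab P)))) hd s _
        (hi.comp ((Option.some_injective _).comp (Option.some_injective _)))
        (fun l => hM (some (some l) : Option (Option (Lab P)))) (fun l => ?_)
      have hne : em (some (some l) : Option (Option (Lab P))) ≠ hd := fun h => by
        have := hi h
        cases this
      simpa [Function.update_of_ne, hne] using hF (some (some l) : Option (Option (Lab P)))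
    have loop : ∀ (n m : ℕ) (s : Mem), RunsIn M (n * (P.time.eval N + 1) + 1)
        ⟨some hd, none, s.stk (Function.update (Function.update F (hd, false) n) (hd, !false) m)⟩
        ⟨some back, none, ((P.exec N)^[n] s).stk
          (Function.update (Function.update F (hd, false) 0) (hd, !false) (m + n))⟩ := by
      intro n
      induction n with
      | zero =>
        intro m s
        simpa using (runsIn_shift_loop s F hMhd 0 m).2
      | succ n ihn =>
        intro m s
        have := ((runsIn_shift_loop s F hMhd n m).1.trans (body s n (m + 1))).trans
          (ihn (m + 1) (P.exec N s))
        rw [add_assoc m 1 n, add_comm 1 n] at this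
        rw [Function.iterate_succ_apply]
        exact this.mono (le_of_eq (by ring))
    -- Returning the tokens re-establishes the assumption on `F`, so that an enclosing loop can
    -- enter this loop again.
    have restore : ∀ (n m : ℕ) (s : Mem), RunsIn M (n + 1)
        ⟨some back, none, s.stk (Function.update (Function.update F (hd, true) n) (hd, !true) m)⟩
        ⟨some ex, none, s.stk
          (Function.update (Function.update F (hd, true) 0) (hd, !true) (m + n))⟩ := by
      intro n
      induction n with
      | zero =>
        intro m s
        simpa using (runsIn_shift_loop s F hMback 0 m).2
      | succ n ihn =>
        intro m s
        have := (runsIn_shift_loop s F hMback n m).1.trans (ihn (m + 1) s)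
        rw [add_assoc m 1 n, add_comm 1 n] at this
        exact this.mono (le_of_eq (by ring))
    have h1 := loop N 0 s
    have h2 := restore N 0 ((P.exec N)^[N] s)
    have hFN : (Function.update (Function.update F (hd, false) N) (hd, !false) 0) = F := by
      have := hF (none : Option (Option (Lab P)))
      rw [← this.1, Function.update_eq_self]
      exact (congrArg _ this.2.symm).trans (Function.update_eq_self _ _)
    have hFN' : (Function.update (Function.update F (hd, true) 0) (hd, !true) (0 + N)) = F := by
      have := hF (none : Option (Option (Lab P)))
      rw [zero_add, ← this.2, Function.update_eq_self]
      exact (congrArg _ this.1.symm).trans (Function.update_eq_self _ _)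
    rw [hFN] at h1
    rw [hFN'] at h2
    have hmid : (Function.update (Function.update F (hd, false) 0) (hd, !false) (0 + N)) =
        (Function.update (Function.update F (hd, true) N) (hd, !true) 0) := by
      rw [Function.update_comm (by simp)]
      simp
    rw [hmid] at h1
    refine (h1.trans h2).mono (le_of_eq ?_)
    simp only [time, Polynomial.eval_add, Polynomial.eval_mul, Polynomial.eval_X,
      Polynomial.eval_ofNat]
    ring

end Cmd

/-! ### Preparing the loop stacks; polynomial time. -/

namespace Cmd

section Machine

variable {L : Type} [DecidableEq L]

/-- Put a symbol on the first loop stack of each program point of a list. -/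
def pushAll (ls : List L) (q : MStmt L) : MStmt L :=
  ls.foldr (fun l q => .push (.inr (.inr (l, false))) (fun _ => none) q) q

/-- Remove a symbol from the first loop stack of each program point of a list. -/
def popAll (ls : List L) (q : MStmt L) : MStmt L :=
  ls.foldr (fun l q => .pop (.inr (.inr (l, false))) (fun v _ => v) q) q

theorem stepAux_pushAll (ls : List L) (q : MStmt L) (v : Option (Option Bool)) (s : Mem)
    (F : L × Bool → ℕ) :
    TM2.stepAux (pushAll ls q) v (s.stk F) =
      TM2.stepAux q v (s.stk fun i => F i + if i.2 then 0 else ls.count i.1) := by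
  induction ls generalizing F with
  | nil => simp [pushAll]
  | cons l ls ih =>
    have : (none : Option Bool) :: s.stk F (.inr (.inr (l, false))) =
        List.replicate (F (l, false) + 1) none := by simp [Mem.stk, List.replicate_succ]
    change TM2.stepAux (pushAll ls q) v (Function.update (s.stk F) _ (none :: _)) = _
    rw [this, Mem.update_stk_loop, ih]
    congr 2
    funext i
    obtain ⟨l', b⟩ := i
    cases b
    · by_cases h : l' = l
      · subst h; simp; omega
      · simp [h, Ne.symm h]
    · simp

theorem stepAux_popAll (ls : List L) (q : MStmt L) (v : Option (Option Bool)) (s : Mem)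
    (F : L × Bool → ℕ) :
    TM2.stepAux (popAll ls q) v (s.stk F) =
      TM2.stepAux q v (s.stk fun i => F i - if i.2 then 0 else ls.count i.1) := by
  induction ls generalizing F with
  | nil => simp [popAll]
  | cons l ls ih =>
    have : (s.stk F (.inr (.inr (l, false)))).tail =
        List.replicate (F (l, false) - 1) none := by simp only [Mem.stk, replicate_tail]
    change TM2.stepAux (popAll ls q) v (Function.update (s.stk F) _ (List.tail _)) = _
    rw [this, Mem.update_stk_loop, ih]
    congr 2
    funext i
    obtain ⟨l', b⟩ := i
    cases b
    · by_cases h : l' = l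
      · subst h; simp; omega
      · simp [h, Ne.symm h]
    · simp

end Machine

open Classical in
/-- The labels of the machine of a program, in a list. -/
noncomputable def labels (P : Cmd) : List (Lab P ⊕ Fin 3) :=
  have := Fintype.ofFinite (Lab P)
  (Finset.univ : Finset (Lab P ⊕ Fin 3)).toList

open Classical in
-- Without repetitions in the list, one pass over it changes every loop counter by exactly one.
theorem count_labels (P : Cmd) (l : Lab P ⊕ Fin 3) : @List.count _ instBEqOfDecidableEq l P.labels = 1 :=
  @List.count_eq_one_of_mem _ instBEqOfDecidableEq _ _ _ (Finset.nodup_toList _)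
    (by simp [labels])

/-- The machine of a program: it fills the loop stacks with as many symbols as the input has,
runs the program, and empties the loop stacks. -/
noncomputable def machine (P : Cmd) : Lab P ⊕ Fin 3 → MStmt (Lab P ⊕ Fin 3)
  | .inl l => code P Sum.inl (.inr 2) l
  | .inr 0 => .pop (.inr (.inl .inp)) (fun _ v => v) (.branch Option.isSome
      (.push (.inr (.inl .tmp)) (fun v => v.getD none)
        (.load (fun _ => none) (pushAll P.labels (.goto fun _ => .inr 0))))
      (.load (fun _ => none) (.goto fun _ => .inr 1)))
  | .inr 1 => shift (.inr (.inl .tmp)) (.inr (.inl .inp)) (.inr 1) (.inl (entry P))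
  | .inr 2 => .peek (.inr (.inr (.inr 2, false))) (fun _ v => v) (.branch Option.isSome
      (.load (fun _ => none) (popAll P.labels (.goto fun _ => .inr 2)))
      (.load (fun _ => none) .halt))

/-- The loop counters when all the loops are ready to be run `n` times. -/
def full {L : Type} (n : ℕ) (i : L × Bool) : ℕ := if i.2 then 0 else n

open Classical in
-- Popping the input is the only way to count it, so it is kept on `tmp`, in reverse order, while
-- every loop stack receives one token per symbol. The next phase turns it back.
theorem runsIn_fill (P : Cmd) (x z : List (Option Bool)) (n : ℕ) :
    RunsIn P.machine (x.length + 1)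
      ⟨some (.inr 0), none, ({ Mem.blank x [] with tmp := z }).stk (full n)⟩
      ⟨some (.inr 1), none,
        ({ Mem.blank [] [] with tmp := x.reverse ++ z }).stk (full (n + x.length))⟩ := by
  induction x generalizing z n with
  | nil =>
    refine RunsIn.single ?_
    have h : ({ Mem.blank [] [] with tmp := z } : Mem).stk (full n)
        (.inr (.inl .inp) : Stack (Lab P ⊕ Fin 3)) = [] := rfl
    simp only [machine, TM2.stepAux, h, List.head?_nil, Option.isSome_none, cond_false,
      List.tail_nil, List.reverse_nil, List.nil_append, List.length_nil, add_zero]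
    congr 1
    rw [Mem.update_stk_str]
    rfl
  | cons a x ih =>
    have h1 : RunsIn P.machine 1
        ⟨some (.inr 0), none, ({ Mem.blank (a :: x) [] with tmp := z }).stk (full n)⟩
        ⟨some (.inr 0), none, ({ Mem.blank x [] with tmp := a :: z }).stk (full (n + 1))⟩ := by
      refine RunsIn.single ?_
      have h : ({ Mem.blank (a :: x) [] with tmp := z } : Mem).stk (full n)
        (.inr (.inl .inp) : Stack (Lab P ⊕ Fin 3)) = a :: x := rfl
      simp only [machine, TM2.stepAux, h, List.head?_cons, Option.isSome_some, cond_true,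
        List.tail_cons, Option.getD_some]
      rw [Mem.update_stk_str, Mem.update_stk_str, stepAux_pushAll]
      simp only [TM2.stepAux]
      congr 1
      refine congrArg₂ Mem.stk rfl ?_
      funext i
      obtain ⟨l, b⟩ := i
      cases b <;> simp [full, count_labels]
    have := h1.trans (ih (a :: z) (n + 1))
    rw [List.reverse_cons, List.append_assoc, List.singleton_append, List.length_cons,
      Nat.add_comm x.length 1, ← Nat.add_assoc n]
    exact this.mono (by omega)

open Classical in
theorem runsIn_restore (P : Cmd) (x z : List (Option Bool)) (n : ℕ) :
    RunsIn P.machine (z.length + 1)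
      ⟨some (.inr 1), none, ({ Mem.blank x [] with tmp := z }).stk (full n)⟩
      ⟨some (.inl (entry P)), none, (Mem.blank (z.reverse ++ x) []).stk (full n)⟩ := by
  induction z generalizing x with
  | nil =>
    exact RunsIn.single ((stepAux_shift _ _ _ _ _).2 rfl)
  | cons a z ih =>
    have h1 : RunsIn P.machine 1
        ⟨some (.inr 1), none, ({ Mem.blank x [] with tmp := a :: z }).stk (full n)⟩
        ⟨some (.inr 1), none, ({ Mem.blank (a :: x) [] with tmp := z }).stk (full n)⟩ := by
      refine RunsIn.single ?_
      change TM2.stepAux (shift _ _ _ _) _ _ = _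
      rw [(stepAux_shift _ _ _ _ _).1 a z rfl, Mem.update_stk_str, Mem.update_stk_str]
      rfl
    have := h1.trans (ih (a :: x))
    rw [List.reverse_cons, List.append_assoc, List.singleton_append, List.length_cons]
    exact this.mono (by omega)

open Classical in
-- A halting configuration must have nothing but the output on its stacks. All first loop stacks
-- have the same height, so testing a single one is enough.
theorem runsIn_empty (P : Cmd) (s : Mem) (n : ℕ) :
    RunsIn P.machine (n + 1) ⟨some (.inr 2), none, s.stk (full n)⟩
      ⟨none, none, s.stk (full 0)⟩ := by
  induction n with
  | zero => exact RunsIn.single rfl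
  | succ n ih =>
    have h1 : RunsIn P.machine 1 ⟨some (.inr 2), none, s.stk (full (n + 1))⟩
        ⟨some (.inr 2), none, s.stk (full n)⟩ := by
      refine RunsIn.single ?_
      have h : s.stk (full (n + 1)) (.inr (.inr (.inr 2, false)) : Stack (Lab P ⊕ Fin 3)) =
          none :: List.replicate n none := rfl
      simp only [machine, TM2.stepAux, h, List.head?_cons, Option.isSome_some, cond_true]
      rw [stepAux_popAll]
      simp only [TM2.stepAux]
      congr 2
      funext i
      obtain ⟨l, b⟩ := i
      cases b <;> simp [full, count_labels]
    exact (h1.trans ih).mono (by omega)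

open Classical in
/-- The machine of a program, bundled. -/
noncomputable def finTM2 (P : Cmd) : FinTM2 where
  K := Stack (Lab P ⊕ Fin 3)
  kDecidableEq := inferInstance
  kFin := Fintype.ofFinite _
  k₀ := .inr (.inl .inp)
  k₁ := .inr (.inl .out)
  Γ := fun _ => Option Bool
  Λ := Lab P ⊕ Fin 3
  main := .inr 0
  ΛFin := Fintype.ofFinite _
  σ := Option (Option Bool)
  initialState := none
  σFin := inferInstance
  Γk₀Fin := inferInstanceAs (Fintype (Option Bool))
  m := machine P

open Classical in
-- Besides the program there are three linear passes: counting the input, restoring it, and emptying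
-- the loop stacks.
theorem runsIn_machine (P : Cmd) (x y : List (Option Bool))
    (h : P.exec x.length (Mem.blank x []) = Mem.blank [] y) :
    RunsIn P.machine (P.time.eval x.length + 3 * (x.length + 1))
      ⟨some (.inr 0), none, (Mem.blank x []).stk (full 0)⟩
      ⟨none, none, (Mem.blank [] y).stk (full 0)⟩ := by
  have h1 := runsIn_fill P x [] 0
  have h2 := runsIn_restore P [] x.reverse x.length
  rw [List.reverse_reverse, List.append_nil] at h2
  rw [List.append_nil, zero_add] at h1
  have h3 := runsIn_code x.length P.machine P Sum.inl (.inr 2) (Mem.blank x []) (full x.length)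
    Sum.inl_injective (fun _ => rfl) (fun _ => ⟨rfl, rfl⟩)
  rw [h] at h3
  have h4 := runsIn_empty P (Mem.blank [] y) x.length
  refine (((h1.trans h2).trans h3).trans h4).mono ?_
  rw [List.length_reverse]
  omega

theorem stk_blank_inp {L : Type} [DecidableEq L] (x : List (Option Bool)) :
    (Mem.blank x []).stk (full (L := L) 0) =
      fun k => if k = .inr (.inl .inp) then x else [] := by
  funext k
  rcases k with i | i | i
  · cases i <;> rfl
  · cases i <;> rfl
  · simp [Mem.stk, full]

theorem stk_blank_out {L : Type} [DecidableEq L] (x : List (Option Bool)) :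
    (Mem.blank [] x).stk (full (L := L) 0) =
      fun k => if k = .inr (.inl .out) then x else [] := by
  funext k
  rcases k with i | i | i
  · cases i <;> rfl
  · cases i <;> rfl
  · simp [Mem.stk, full]

open Classical in
/-- A function that is computed by a program, with as many iterations in every loop as the input
has symbols, is computable in polynomial time. -/
theorem polyTime {α β : Type} (ea : α → List (Option Bool)) (eb : β → List (Option Bool))
    (f : α → β) (P : Cmd)
    (h : ∀ a, P.exec (ea a).length (Mem.blank (ea a) []) = Mem.blank [] (eb (f a))) :
    Nonempty (TM2ComputableInPolyTime ea eb f) := by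
  refine ⟨{ tm := P.finTM2, inputAlphabet := Equiv.refl _, outputAlphabet := Equiv.refl _,
            time := P.time + 3 * (.X + 1), outputsFun := fun a => ?_ }⟩
  have h1 := runsIn_machine P (ea a) (eb (f a)) (h a)
  have hi : initList P.finTM2 (List.map (Equiv.refl (Option Bool)).invFun (ea a)) =
      ⟨some (.inr 0), none, (Mem.blank (ea a) []).stk (full 0)⟩ := by
    rw [stk_blank_inp]
    exact congrArg (initList P.finTM2) (List.map_id (ea a))
  have ho : haltList P.finTM2 (List.map (Equiv.refl (Option Bool)).invFun (eb (f a))) =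
      ⟨none, none, (Mem.blank [] (eb (f a))).stk (full 0)⟩ := by
    rw [stk_blank_out]
    exact congrArg (haltList P.finTM2) (List.map_id (eb (f a)))
  refine Classical.choice ?_
  obtain ⟨m, hm, e⟩ := h1
  refine ⟨⟨⟨m, ?_⟩, ?_⟩⟩
  · refine Eq.trans ?_ (e.trans (congrArg some ho.symm))
    exact congrArg (fun c => (flip bind (TM2.step P.machine))^[m] (some c)) hi
  · simpa using hm

end Cmd

/-! ### Frame property and arithmetic with unary counters. -/

set_option linter.constructorNameAsVariable false

infixr:60 " ⨾ " => Cmd.seq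

namespace Cmd

variable {N : ℕ}

/-- Run a program `N ^ 30` times. -/
def loop (P : Cmd) : Cmd := rep^[30] P

theorem exec_loop (P : Cmd) (s : Mem) : exec N (loop P) s = (exec N P)^[N ^ 30] s := by
  have : ∀ (n : ℕ) (P : Cmd), exec N (rep^[n] P) = (exec N P)^[N ^ n] := by
    intro n
    induction n with
    | zero => intro P; simp
    | succ n ih =>
      intro P
      rw [Function.iterate_succ_apply, ih, pow_succ', Function.iterate_mul]
      rfl
  exact congrFun (this 30 P) s

/-- The program refers to a counter. -/
def uses : Cmd → Reg → Bool
  | skip, _ | push _ _, _ | pop _, _ => false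
  | inc r, r' | dec r, r' => r = r'
  | seq P Q, r | ifs _ _ P Q, r => uses P r || uses Q r
  | ifz r P Q, r' => (r = r' : Bool) || uses P r' || uses Q r'
  | rep P, r => uses P r

theorem iterate_set {f : Mem → Mem} {r : Reg} (h : ∀ s v, f (s.set r v) = (f s).set r v) (n : ℕ)
    (s : Mem) (v : ℕ) : f^[n] (s.set r v) = (f^[n] s).set r v := by
  induction n generalizing s with
  | zero => rfl
  | succ n ih => rw [Function.iterate_succ_apply, h, ih, Function.iterate_succ_apply]

/-- A counter that a program does not refer to does not matter for it. -/
theorem exec_set (P : Cmd) {r : Reg} (h : P.uses r = false) (s : Mem) (v : ℕ) :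
    exec N P (s.set r v) = (exec N P s).set r v := by
  induction P generalizing s v with
  | skip => rfl
  | inc r' | dec r' =>
    simp only [uses, decide_eq_false_iff_not] at h
    simp only [exec, Mem.get_set, if_neg h]
    rw [Mem.set_comm _ (Ne.symm h)]
  | push k a | pop k => simp only [exec, Mem.gets_set, Mem.sets_set]
  | seq P Q ihP ihQ =>
    simp only [uses, Bool.or_eq_false_iff] at h
    simp only [exec, ihP h.1, ihQ h.2]
  | ifz r' P Q ihP ihQ =>
    simp only [uses, Bool.or_eq_false_iff, decide_eq_false_iff_not] at h
    simp only [exec, Mem.get_set, if_neg h.1.1, ihP h.1.2, ihQ h.2]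
    cases s.get r' == 0 <;> rfl
  | ifs k p P Q ihP ihQ =>
    simp only [uses, Bool.or_eq_false_iff] at h
    simp only [exec, Mem.gets_set, ihP h.1, ihQ h.2]
    cases p (s.gets k).head? <;> rfl
  | rep P ih => exact iterate_set (fun s v => ih h s v) N s v

theorem get_exec (P : Cmd) {r : Reg} (h : P.uses r = false) (s : Mem) :
    (exec N P s).get r = s.get r := by
  -- Overwriting `r` by its own value changes nothing, and this overwriting commutes with the
  -- program.
  conv_lhs => rw [← Mem.set_get s r, exec_set P h, Mem.get_set, if_pos rfl]

/-- Count a counter down, running a program each time. -/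
def down (x : Reg) (P : Cmd) : Cmd := loop (ifz x skip (dec x ⨾ P))

/-- A fixed number of rounds imitates a loop of variable length: when `x` has reached zero, all the
remaining rounds are idle. The other loops below end in the same way. -/
theorem exec_down {x : Reg} {P : Cmd} (h : P.uses x = false) {s : Mem} (hs : s.get x ≤ N ^ 30) :
    exec N (down x P) s = ((exec N P)^[s.get x] s).set x 0 := by
  rw [down, exec_loop]
  generalize N ^ 30 = n at hs
  induction n generalizing s with
  | zero =>
    have : s.get x = 0 := by omega
    rw [this]
    conv_lhs => rw [← Mem.set_get s x, this]
    rfl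
  | succ n ih =>
    rw [Function.iterate_succ_apply]
    rcases hm : s.get x with _ | m
    · rw [Function.iterate_fixed]
      · simp only [exec, hm, beq_self_eq_true, cond_true]
        conv_lhs => rw [← Mem.set_get s x, hm]
        rfl
      · simp [exec, hm]
    · have h1 : exec N (ifz x skip (dec x ⨾ P)) s = (exec N P s).set x m := by
        simp only [exec, hm, Nat.add_sub_cancel]
        exact exec_set P h s m
      rw [h1, ih (by rw [Mem.get_set, if_pos rfl]; omega), Mem.get_set, if_pos rfl,
        iterate_set (fun s v => exec_set P h s v), Mem.set_set, Function.iterate_succ_apply]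

theorem iterate_inc (r : Reg) (n : ℕ) (s : Mem) :
    (exec N (inc r))^[n] s = s.set r (s.get r + n) := by
  induction n generalizing s with
  | zero => simp [Mem.set_get]
  | succ n ih =>
    rw [Function.iterate_succ_apply, ih]
    simp only [exec, Mem.set_set, Mem.get_set, if_true]
    congr 1
    omega

/-- Run a program as often as a counter says, saving the counter in another one. -/
def times (x t : Reg) (P : Cmd) : Cmd := down x (inc t ⨾ P) ⨾ down t (inc x)

theorem exec_times {x t : Reg} {P : Cmd} (hxt : x ≠ t) (hx : P.uses x = false)
    (ht : P.uses t = false) {s : Mem} (hs : s.get x ≤ N ^ 30) (hs' : s.get t = 0) :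
    exec N (times x t P) s = (exec N P)^[s.get x] s := by
  have h1 : ∀ (n : ℕ) (s : Mem), (exec N (inc t ⨾ P))^[n] s =
      ((exec N P)^[n] s).set t (s.get t + n) := by
    intro n
    induction n with
    | zero => intro s; simp [Mem.set_get]
    | succ n ih =>
      intro s
      rw [Function.iterate_succ_apply, ih, Function.iterate_succ_apply]
      simp only [exec]
      rw [exec_set P ht, Mem.get_set, if_pos rfl, iterate_set (fun s v => exec_set P ht s v),
        Mem.set_set]
      congr 1
      omega
  have hg : ∀ n, ((exec N P)^[n] s).get t = 0 := by
    intro n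
    induction n with
    | zero => exact hs'
    | succ n ih => rw [Function.iterate_succ_apply', get_exec P ht, ih]
  have hg' : ∀ n, ((exec N P)^[n] s).get x = s.get x := by
    intro n
    induction n with
    | zero => rfl
    | succ n ih => rw [Function.iterate_succ_apply', get_exec P hx, ih]
  simp only [times, exec]
  rw [exec_down (by simp [uses, hx, Ne.symm hxt]) hs, h1, hs', zero_add,
    exec_down (by simp [uses, hxt]) (by
      rw [Mem.get_set, if_neg (Ne.symm hxt), Mem.get_set, if_pos rfl]; exact hs),
    iterate_inc]
  simp only [Mem.get_set, if_true, if_neg (Ne.symm hxt), zero_add]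
  have e1 : ((exec N P)^[s.get x] s).set t 0 = (exec N P)^[s.get x] s := by
    conv_rhs => rw [← Mem.set_get ((exec N P)^[s.get x] s) t, hg]
  have e2 : ((exec N P)^[s.get x] s).set x (s.get x) = (exec N P)^[s.get x] s := by
    conv_rhs => rw [← Mem.set_get ((exec N P)^[s.get x] s) x, hg']
  rw [Mem.set_set, Mem.set_comm _ hxt, Mem.set_set, e1, e2]

/-- Add a counter to another one, and clear it. -/
def move (x y : Reg) : Cmd := down x (inc y)

theorem exec_move {x y : Reg} (h : y ≠ x) {s : Mem} (hs : s.get x ≤ N ^ 30) :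
    exec N (move x y) s = (s.set y (s.get y + s.get x)).set x 0 := by
  rw [move, exec_down (by simp [uses, h]) hs, iterate_inc]

/-- Add a counter to another one. -/
def copy (x y : Reg) : Cmd := times x .t (inc y)

theorem exec_copy {x y : Reg} (h : y ≠ x) (hx : x ≠ .t) (hy : y ≠ .t) {s : Mem}
    (hs : s.get x ≤ N ^ 30) (ht : s.t = 0) :
    exec N (copy x y) s = s.set y (s.get y + s.get x) := by
  rw [copy, exec_times hx (by simp [uses, h]) (by simp [uses, hy]) hs ht, iterate_inc]

/-- Clear a counter. -/
def clear (x : Reg) : Cmd := loop (dec x)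

theorem exec_clear {x : Reg} {s : Mem} (hs : s.get x ≤ N ^ 30) :
    exec N (clear x) s = s.set x 0 := by
  have : ∀ (n : ℕ) (s : Mem), (exec N (dec x))^[n] s = s.set x (s.get x - n) := by
    intro n
    induction n with
    | zero => intro s; simp [Mem.set_get]
    | succ n ih =>
      intro s
      rw [Function.iterate_succ_apply, ih]
      simp only [exec, Mem.set_set, Mem.get_set, if_true]
      congr 1
      omega
  rw [clear, exec_loop, this, Nat.sub_eq_zero_of_le hs]

/-! ### Divisibility, primality and the search for the next prime. -/

/-- One step of counting modulo `z + y`. -/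
def modStep : Cmd := dec .z ⨾ inc .y ⨾ ifz .z (move .y .z) skip

/-- The sum `z + y` stays equal to `e`: each step moves a unit from `z` to `y`, and when `z` runs
empty, all of `y` is moved back, which is the reduction modulo `e`. -/
theorem iterate_modStep {e : ℕ} (he : 0 < e) (heN : e ≤ N ^ 30) (s : Mem) (hz : s.z = e)
    (hy : s.y = 0) (n : ℕ) :
    (exec N modStep)^[n] s = { s with z := e - n % e, y := n % e } := by
  induction n with
  | zero => cases s; subst hz hy; simp
  | succ n ih =>
    rw [Function.iterate_succ_apply', ih]
    have hlt := Nat.mod_lt n he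
    simp only [modStep, exec, Mem.set, Mem.get]
    rcases h : (e - n % e - 1 == 0) with _ | _
    rotate_left
    · rw [cond_true]
      replace h := eq_of_beq h
      have h1 : (n + 1) % e = 0 := by
        rw [Nat.add_mod, show n % e = e - 1 by omega]
        rcases Nat.lt_or_ge 1 e with h2 | h2
        · rw [Nat.mod_eq_of_lt h2, Nat.sub_add_cancel he, Nat.mod_self]
        · rw [show e = 1 by omega, Nat.mod_one]
      rw [exec_move (by decide) (by simp only [Mem.get]; omega), h1]
      simp only [Mem.set, Mem.get, Mem.mk.injEq, and_true, true_and]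
      omega
    · rw [cond_false]
      replace h := ne_of_beq_false h
      have h1 : (n + 1) % e = n % e + 1 := by
        rw [Nat.add_mod, Nat.mod_eq_of_lt (show 1 < e by omega), Nat.mod_eq_of_lt (by omega)]
      rw [h1]
      simp only [Mem.mk.injEq, and_true, true_and]
      omega

/-- Increase `f` if `e` divides `c`, and decrease `e`. -/
def divTest : Cmd :=
  copy .e .z ⨾ times .c .t modStep ⨾ ifz .y (inc .f) skip ⨾ clear .y ⨾ clear .z ⨾ dec .e

theorem exec_divTest {s : Mem} (he : 0 < s.e) (heN : s.e ≤ N ^ 30) (hc : s.c ≤ N ^ 30)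
    (hz : s.z = 0) (hy : s.y = 0) (ht : s.t = 0) :
    exec N divTest s = { s with f := s.f + (if s.e ∣ s.c then 1 else 0), e := s.e - 1 } := by
  have hlt := Nat.mod_lt s.c he
  simp only [divTest, exec]
  rw [exec_copy (by decide) (by decide) (by decide) heN ht,
    exec_times (by decide) rfl rfl (by simpa [Mem.set, Mem.get] using hc)
      (by simpa [Mem.set, Mem.get] using ht),
    iterate_modStep he heN _ (by simp [Mem.set, Mem.get, hz]) (by simp [Mem.set, hy])]
  simp only [Mem.set, Mem.get]
  rcases h1 : (s.c % s.e == 0) with _ | _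
  · have h2 : ¬ s.e ∣ s.c := fun h => ne_of_beq_false h1 (Nat.mod_eq_zero_of_dvd h)
    rw [cond_false, if_neg h2]
    rw [exec_clear (x := .y) (by simp only [Mem.get]; omega),
      exec_clear (x := .z) (by simp [Mem.get, Mem.set]; omega)]
    simp [Mem.set, hz, hy]
  · rw [cond_true, if_pos (Nat.dvd_of_mod_eq_zero (eq_of_beq h1))]
    rw [exec_clear (x := .y) (by simp only [Mem.get]; omega),
      exec_clear (x := .z) (by simp [Mem.get, Mem.set]; omega)]
    simp [Mem.set, hz, hy]

/-- Compute in `f` the number of proper divisors of `c`, less one. -/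
def primeTest : Cmd := copy .c .e ⨾ dec .e ⨾ loop (ifz .e skip divTest) ⨾ dec .f

theorem iterate_divTest {s : Mem} (n : ℕ) (hn : s.e ≤ n) (heN : s.e ≤ N ^ 30)
    (hc : s.c ≤ N ^ 30) (hz : s.z = 0) (hy : s.y = 0) (ht : s.t = 0) :
    (exec N (ifz .e skip divTest))^[n] s =
      { s with f := s.f + ((Finset.Ico 1 (s.e + 1)).filter (· ∣ s.c)).card, e := 0 } := by
  induction n generalizing s with
  | zero =>
    cases s
    obtain rfl := Nat.le_zero.1 hn
    simp
  | succ n ih =>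
    rw [Function.iterate_succ_apply]
    rcases Nat.eq_zero_or_pos s.e with h | h
    · rw [Function.iterate_fixed]
      · cases s
        subst h
        simp [exec, Mem.get]
      · simp [exec, Mem.get, h]
    · have h1 : exec N (ifz .e skip divTest) s = exec N divTest s := by
        simp only [exec, Mem.get, beq_eq_false_iff_ne.2 h.ne', cond_false]
      rw [h1, exec_divTest h heN hc hz hy ht, ih (s := { s with f := s.f + (if s.e ∣ s.c then 1 else 0), e := s.e - 1 })
        (by simp; omega) (by simp; omega) hc hz hy ht]
      obtain ⟨m, hm⟩ : ∃ m, s.e = m + 1 := ⟨s.e - 1, by omega⟩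
      simp only [hm, Nat.add_sub_cancel, Mem.mk.injEq, and_true, true_and]
      rw [← Finset.insert_Ico_right_eq_Ico_add_one (show 1 ≤ m + 1 by omega), Finset.filter_insert]
      split_ifs
      · rw [Finset.card_insert_of_notMem (by simp)]; omega
      · rfl

theorem exec_primeTest {s : Mem} (hc0 : 2 ≤ s.c) (hc : s.c ≤ N ^ 30) (he : s.e = 0)
    (hf : s.f = 0) (hz : s.z = 0) (hy : s.y = 0) (ht : s.t = 0) :
    exec N primeTest s = { s with f := s.c.properDivisors.card - 1 } := by
  simp only [primeTest, exec]
  rw [exec_copy (by decide) (by decide) (by decide) hc ht, exec_loop,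
    iterate_divTest (s := (s.set .e (s.get .e + s.get .c)).set .e
      ((s.set .e (s.get .e + s.get .c)).get .e - 1)) (N ^ 30) (by simp [Mem.set, Mem.get]; omega)
      (by simp [Mem.set, Mem.get]; omega) hc hz hy ht]
  simp only [Mem.set, Mem.get, he, hf, zero_add]
  rw [Nat.sub_add_cancel (by omega), ← Nat.properDivisors]

end Cmd

/-- The least prime number above `n`. -/
def nextPrime (n : ℕ) : ℕ := Nat.find (Nat.exists_infinite_primes (n + 1))

theorem prime_nextPrime (n : ℕ) : (nextPrime n).Prime :=
  (Nat.find_spec (Nat.exists_infinite_primes (n + 1))).2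

theorem lt_nextPrime (n : ℕ) : n < nextPrime n :=
  (Nat.find_spec (Nat.exists_infinite_primes (n + 1))).1

theorem nextPrime_le {n p : ℕ} (hp : p.Prime) (h : n < p) : nextPrime n ≤ p :=
  Nat.find_min' _ ⟨h, hp⟩

namespace Cmd

variable {N : ℕ}

/-- Replace `c` by the next prime number. -/
def toNextPrime : Cmd :=
  inc .c ⨾ inc .g ⨾ loop (ifz .g skip (primeTest ⨾ ifz .f (dec .g) (clear .f ⨾ inc .c)))

/-- The number 1 is always a proper divisor here; being prime means that it is the only one. -/
theorem card_properDivisors_sub_one {n : ℕ} (h : 2 ≤ n) :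
    n.properDivisors.card - 1 = 0 ↔ n.Prime := by
  rw [← Nat.properDivisors_eq_singleton_one_iff_prime]
  have h1 : 1 ∈ n.properDivisors := Nat.one_mem_properDivisors_iff_one_lt.2 h
  constructor
  · intro h2
    have : n.properDivisors.card = 1 := by have := Finset.card_pos.2 ⟨1, h1⟩; omega
    obtain ⟨a, ha⟩ := Finset.card_eq_one.1 this
    rw [ha] at h1 ⊢
    rw [Finset.mem_singleton.1 h1]
  · intro h2
    rw [h2]
    rfl

/-- The counter `g` is the flag that the search is still on, and `j` is the distance to the prime
sought. Clearing `g` makes the remaining rounds idle. -/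
theorem iterate_search {p : ℕ} (hp : p.Prime) (hpN : p ≤ N ^ 30) (j : ℕ) :
    ∀ (s : Mem) (n : ℕ), j < n → s.c + j = p → 2 ≤ s.c →
      (∀ q, s.c ≤ q → q < p → ¬ q.Prime) → s.g = 1 → s.e = 0 → s.f = 0 → s.z = 0 → s.y = 0 →
      s.t = 0 →
      (exec N (ifz .g skip (primeTest ⨾ ifz .f (dec .g) (clear .f ⨾ inc .c))))^[n] s =
        { s with c := p, g := 0 } := by
  induction j with
  | zero =>
    intro s n hn hj h2 hq hg he hf hz hy ht
    obtain ⟨n, rfl⟩ : ∃ m, n = m + 1 := ⟨n - 1, by omega⟩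
    have hc : s.c = p := by omega
    have h0 := (card_properDivisors_sub_one h2).2 (hc ▸ hp)
    have h1 : exec N (ifz .g skip (primeTest ⨾ ifz .f (dec .g) (clear .f ⨾ inc .c))) s =
        { s with c := p, g := 0 } := by
      simp only [exec, Mem.get, hg, show ((1 : ℕ) == 0) = false from rfl, cond_false]
      rw [exec_primeTest h2 (by omega) he hf hz hy ht]
      cases s
      subst hf hg hc
      simp [h0, Mem.set]
    rw [Function.iterate_succ_apply, h1, Function.iterate_fixed]
    simp [exec, Mem.get]
  | succ j ih =>
    intro s n hn hj h2 hq hg he hf hz hy ht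
    obtain ⟨n, rfl⟩ : ∃ m, n = m + 1 := ⟨n - 1, by omega⟩
    have h0 : s.c.properDivisors.card - 1 ≠ 0 := fun h =>
      hq s.c le_rfl (by omega) ((card_properDivisors_sub_one h2).1 h)
    have hle : s.c.properDivisors.card ≤ s.c := by
      have := Finset.card_filter_le (Finset.Ico 1 s.c) (· ∣ s.c)
      rw [Nat.card_Ico] at this
      exact this.trans (Nat.sub_le _ _)
    have h1 : exec N (ifz .g skip (primeTest ⨾ ifz .f (dec .g) (clear .f ⨾ inc .c))) s =
        { s with c := s.c + 1 } := by
      simp only [exec, Mem.get, hg, show ((1 : ℕ) == 0) = false from rfl, cond_false]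
      rw [exec_primeTest h2 (by omega) he hf hz hy ht]
      simp only [beq_eq_false_iff_ne.2 h0, cond_false]
      rw [exec_clear (by simp only [Mem.get]; omega)]
      cases s
      subst hf hg
      simp [Mem.set]
    rw [Function.iterate_succ_apply, h1, ih { s with c := s.c + 1 } n (by omega) (by simp; omega) (by simp; omega)
      (fun q h => hq q (by simp at h; omega)) hg he hf hz hy ht]

end Cmd

/-- The auxiliary registers are clear. -/
def Mem.Clean (s : Mem) : Prop :=
  s.t = 0 ∧ s.e = 0 ∧ s.z = 0 ∧ s.y = 0 ∧ s.f = 0 ∧ s.g = 0 ∧ s.k = 0 ∧ s.h = 0 ∧ s.o = 0 ∧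
    s.tmp = []

namespace Cmd

variable {N : ℕ}

theorem exec_toNextPrime {s : Mem} (hs : s.Clean) (hc : 1 ≤ s.c) (hN : nextPrime s.c ≤ N ^ 30) :
    exec N toNextPrime s = { s with c := nextPrime s.c } := by
  obtain ⟨ht, he, hz, hy, hf, hg, -⟩ := hs
  have hlt := lt_nextPrime s.c
  simp only [toNextPrime, exec, Mem.set, Mem.get]
  rw [exec_loop, iterate_search (prime_nextPrime s.c) hN (nextPrime s.c - s.c - 1)
    { s with c := s.c + 1, g := s.g + 1 } _
    (by omega) (by simp; omega) (by simp; omega)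
    (fun q h1 h2 h3 => by simp at h1; have := nextPrime_le h3 (show s.c < q by omega); omega)
    (by simp [hg]) he hf hz hy ht]
  cases s
  subst hg
  rfl

end Cmd

/-! ### Binary numbers: multiplication by a counter and output. -/

/-- The number with given binary digits, the least significant digit being the first one. -/
def binVal : List (Option Bool) → ℕ
  | [] => 0
  | x :: l => (x == some true).toNat + 2 * binVal l

/-- The last `n` binary digits of a number, the least significant digit being the first one. -/
def binDigits : ℕ → ℕ → List (Option Bool)
  | 0, _ => []
  | n + 1, v => some (v % 2 == 1) :: binDigits n (v / 2)

theorem length_binDigits (n v : ℕ) : (binDigits n v).length = n := by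
  induction n generalizing v with
  | zero => rfl
  | succ n ih => simp [binDigits, ih]

theorem binVal_binDigits {n v : ℕ} (h : v < 2 ^ n) : binVal (binDigits n v) = v := by
  induction n generalizing v with
  | zero => simp only [pow_zero, Nat.lt_one_iff] at h; subst h; rfl
  | succ n ih =>
    simp only [binDigits, binVal]
    rw [ih (by rw [pow_succ] at h; omega)]
    rcases Nat.mod_two_eq_zero_or_one v with h' | h' <;> simp [h'] <;> omega

/-- All the symbols of a list are bits. -/
def AllBits (l : List (Option Bool)) : Prop := none ∉ l

theorem allBits_binDigits (n v : ℕ) : AllBits (binDigits n v) := by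
  induction n generalizing v with
  | zero => simp [AllBits, binDigits]
  | succ n ih => simpa [AllBits, binDigits] using ih _

/-- Remove the zeros at the end of a list. -/
def stripZeros (l : List (Option Bool)) : List (Option Bool) :=
  (l.reverse.dropWhile (· == some false)).reverse

theorem stripZeros_cons (a : Option Bool) (l : List (Option Bool)) :
    stripZeros (a :: l) =
      if stripZeros l = [] then (if a = some false then [] else [a]) else a :: stripZeros l := by
  simp only [stripZeros, List.reverse_cons, List.dropWhile_append, List.reverse_eq_nil_iff]
  by_cases h : List.dropWhile (· == some false) l.reverse = []
  · simp only [h, List.isEmpty_nil, if_true, List.dropWhile_cons, beq_iff_eq, List.dropWhile_nil]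
    split_ifs <;> rfl
  · rw [if_neg (by simpa using h), if_neg h]
    simp

theorem stripZeros_binDigits_zero (n : ℕ) : stripZeros (binDigits n 0) = [] := by
  induction n with
  | zero => rfl
  | succ n ih =>
    have : binDigits (n + 1) 0 = some false :: binDigits n 0 := rfl
    rw [this, stripZeros_cons, if_pos ih, if_pos rfl]

/-- The standard encoding also starts with the least significant digit and ends with a one. In the
induction the low digit survives the stripping because the encoding of the higher digits is
nonempty. -/
theorem stripZeros_binDigits_posNum (p : PosNum) {n : ℕ} (h : (p : ℕ) < 2 ^ n) :
    stripZeros (binDigits n p) = (Computability.encodePosNum p).map some := by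
  induction p generalizing n with
  | one =>
    rcases n with _ | n
    · simp at h
    · have : binDigits (n + 1) ((PosNum.one : PosNum) : ℕ) = some true :: binDigits n 0 := rfl
      rw [this, stripZeros_cons, if_pos (stripZeros_binDigits_zero n)]
      rfl
  | bit0 p ih =>
    rcases n with _ | n
    · have := PosNum.cast_pos (α := ℕ) p.bit0
      rw [pow_zero] at h
      omega
    · rw [PosNum.cast_bit0] at h ⊢
      rw [binDigits, stripZeros_cons, show ((p : ℕ) + p) / 2 = p by omega,
        ih (by rw [pow_succ] at h; omega),
        if_neg (by simpa using Computability.encodePosNum_nonempty p),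
        show ((p : ℕ) + p) % 2 = 0 by omega]
      rfl
  | bit1 p ih =>
    rcases n with _ | n
    · have := PosNum.cast_pos (α := ℕ) p.bit1
      rw [pow_zero] at h
      omega
    · rw [PosNum.cast_bit1] at h ⊢
      rw [binDigits, stripZeros_cons, show ((p : ℕ) + p + 1) / 2 = p by omega,
        ih (by rw [pow_succ] at h; omega),
        if_neg (by simpa using Computability.encodePosNum_nonempty p),
        show ((p : ℕ) + p + 1) % 2 = 1 by omega]
      rfl

theorem stripZeros_binDigits {n v : ℕ} (h : v < 2 ^ n) :
    stripZeros (binDigits n v) = (Computability.encodeNat v).map some := by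
  have hv : ((v : Num) : ℕ) = v := Num.to_of_nat v
  rw [Computability.encodeNat]
  generalize (v : Num) = m at hv
  subst hv
  cases m with
  | zero => exact stripZeros_binDigits_zero n
  | pos p => exact stripZeros_binDigits_posNum p h

namespace Cmd

variable {N : ℕ}

/-- Divide `k` by two: the quotient is added to `h` and the remainder to `o`. -/
def halve : Cmd := loop (ifz .k skip (dec .k ⨾ ifz .k (inc .o) (dec .k ⨾ inc .h)))

theorem exec_halve {s : Mem} (hk : s.k ≤ N ^ 30) :
    exec N halve s = { s with k := 0, h := s.h + s.k / 2, o := s.o + s.k % 2 } := by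
  rw [halve, exec_loop]
  generalize N ^ 30 = n at hk
  induction n generalizing s with
  | zero =>
    cases s
    obtain rfl := Nat.le_zero.1 hk
    simp
  | succ n ih =>
    rw [Function.iterate_succ_apply]
    rcases h : s.k with _ | _ | k
    · rw [Function.iterate_fixed]
      · cases s; subst h; simp [exec, Mem.get]
      · cases s; subst h; simp [exec, Mem.get]
    · have : exec N (ifz .k skip (dec .k ⨾ ifz .k (inc .o) (dec .k ⨾ inc .h))) s =
          { s with k := 0, o := s.o + 1 } := by
        simp [exec, Mem.get, Mem.set, h]
      rw [this, ih (s := { s with k := 0, o := s.o + 1 }) (by simp)]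
      simp
    · have : exec N (ifz .k skip (dec .k ⨾ ifz .k (inc .o) (dec .k ⨾ inc .h))) s =
          { s with k := k, h := s.h + 1 } := by
        simp [exec, Mem.get, Mem.set, h]
      rw [this, ih (s := { s with k := k, h := s.h + 1 }) (by simp; omega)]
      simp only [Mem.mk.injEq, true_and, and_true]
      omega

/-- The factors of multiplications. -/
def IsFactor (r : Reg) : Prop := r = .c ∨ r = .d ∨ r = .a

/-- Multiply the first digit of `bin` by a counter, `k` being the carry. -/
def mulStep (r : Reg) : Cmd :=
  ifs .bin (· == some (some true)) (times r .t (inc .k)) skip ⨾ pop .bin ⨾ halve ⨾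
    ifz .o (push .tmp (some false)) (dec .o ⨾ push .tmp (some true)) ⨾ move .h .k

theorem exec_mulStep {r : Reg} (hr : IsFactor r) {s : Mem} (ht : s.t = 0) (hh : s.h = 0)
    (ho : s.o = 0) (hk : s.k + s.get r ≤ N ^ 30) :
    exec N (mulStep r) s =
      let v := s.k + (s.bin.head? == some (some true)).toNat * s.get r
      { s with bin := s.bin.tail, k := v / 2, tmp := some (v % 2 == 1) :: s.tmp } := by
  have h1 : exec N (ifs .bin (· == some (some true)) (times r .t (inc .k)) skip) s =
      { s with k := s.k + (s.bin.head? == some (some true)).toNat * s.get r } := by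
    simp only [exec, Mem.gets]
    cases s.bin.head? == some (some true)
    · simp
    · rw [cond_true, exec_times (x := r) (t := .t) (by rcases hr with rfl | rfl | rfl <;> decide)
        (by rcases hr with rfl | rfl | rfl <;> rfl) rfl (by omega) ht, iterate_inc]
      simp [Mem.set, Mem.get]
  have h2 : ∀ n, s.k + (s.bin.head? == some (some true)).toNat * s.get r = n → n ≤ N ^ 30 := by
    rintro n rfl
    cases s.bin.head? == some (some true)
    · simp; omega
    · simpa using hk
  rw [mulStep, exec, h1]
  generalize s.k + (s.bin.head? == some (some true)).toNat * s.get r = v at h2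
  replace h2 := h2 v rfl
  simp only [exec]
  rw [exec_halve (by simpa [Mem.sets] using h2)]
  simp only [Mem.sets, Mem.gets, Mem.get, hh, ho, zero_add]
  rcases Nat.mod_two_eq_zero_or_one v with h | h
  · rw [h, show ((0 : ℕ) == 0) = true from rfl, cond_true,
      exec_move (by decide) (by simp only [Mem.get]; omega)]
    cases s; subst hh ho; simp [Mem.set, Mem.get]
  · rw [h, show ((1 : ℕ) == 0) = false from rfl, cond_false,
      exec_move (by decide) (by simp only [Mem.get, Mem.set]; omega)]
    cases s; subst hh ho; simp [Mem.set, Mem.get]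

/-- Schoolbook multiplication with a unary carry. A carry of at most the factor gives a column value
of at most twice the factor, so the next carry is again at most the factor and the counter stays
small. Beyond the end of `bin` the digits count as zero. -/
theorem iterate_mulStep {r : Reg} (hr : IsFactor r) (n : ℕ) {s : Mem} (ht : s.t = 0)
    (hh : s.h = 0) (ho : s.o = 0) (hkr : s.k ≤ s.get r) (hk : 2 * s.get r ≤ N ^ 30)
    (hl : s.bin.length ≤ n) (hv : s.k + s.get r * binVal s.bin < 2 ^ n) :
    (exec N (mulStep r))^[n] s = { s with
      bin := [], k := 0,
      tmp := (binDigits n (s.k + s.get r * binVal s.bin)).reverse ++ s.tmp } := by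
  induction n generalizing s with
  | zero =>
    cases s
    obtain rfl := List.length_eq_zero_iff.1 (Nat.le_zero.1 hl)
    simp only [binVal, mul_zero, add_zero, pow_zero, Nat.lt_one_iff] at hv
    subst hv
    simp [binDigits]
  | succ n ih =>
    rw [Function.iterate_succ_apply, exec_mulStep hr ht hh ho (by omega)]
    set v := s.k + (s.bin.head? == some (some true)).toNat * s.get r with hvdef
    have hv2 : s.k + s.get r * binVal s.bin = v + 2 * (s.get r * binVal s.bin.tail) := by
      rw [hvdef]
      rcases s.bin with _ | ⟨x, l⟩
      · simp [binVal]
      · simp only [binVal, List.head?_cons, List.tail_cons, Option.some_beq_some]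
        ring
    have hvle : v ≤ 2 * s.get r := by
      rw [hvdef]
      cases s.bin.head? == some (some true) <;> simp <;> omega
    set s' : Mem := { s with bin := s.bin.tail, k := v / 2, tmp := some (v % 2 == 1) :: s.tmp }
      with hs'
    have hg : s'.get r = s.get r := by rcases hr with rfl | rfl | rfl <;> rfl
    rw [ih (s := s') ht hh ho (by rw [hg]; simp only [hs']; omega) (by rw [hg]; omega)
      (by simp [hs']; omega)
      (by rw [hg]; simp only [hs']; rw [hv2, pow_succ] at hv; omega)]
    rw [hg]
    simp only [hs', hv2, binDigits, Mem.mk.injEq, true_and]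
    rw [show (v + 2 * (s.get r * binVal s.bin.tail)) % 2 = v % 2 by omega,
      show (v + 2 * (s.get r * binVal s.bin.tail)) / 2 =
        v / 2 + s.get r * binVal s.bin.tail by omega]
    simp

/-- Move the bits at the top of a string to another one. -/
def moveBits (i j : Str) : Cmd :=
  loop (ifs i (· == some (some true)) (pop i ⨾ push j (some true))
    (ifs i (· == some (some false)) (pop i ⨾ push j (some false)) skip))

theorem exec_moveBits {i j : Str} (hij : j ≠ i) {s : Mem} (h : AllBits (s.gets i))
    (hl : (s.gets i).length ≤ N ^ 30) :
    exec N (moveBits i j) s =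
      (s.sets j ((s.gets i).reverse ++ s.gets j)).sets i [] := by
  rw [moveBits, exec_loop]
  generalize N ^ 30 = n at hl
  induction n generalizing s with
  | zero =>
    have := List.length_eq_zero_iff.1 (Nat.le_zero.1 hl)
    rw [this]
    cases s
    cases i <;> cases j <;> simp [Mem.gets] at this hij <;> subst this <;> rfl
  | succ n ih =>
    rw [Function.iterate_succ_apply]
    rcases hx : s.gets i with _ | ⟨_ | b, l⟩
    · rw [Function.iterate_fixed]
      · cases s
        cases i <;> cases j <;> simp [Mem.gets] at hx hij <;> subst hx <;> rfl
      · simp [exec, hx]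
    · exact absurd h (by simp [hx, AllBits])
    · have h1 : exec N (ifs i (· == some (some true)) (pop i ⨾ push j (some true))
          (ifs i (· == some (some false)) (pop i ⨾ push j (some false)) skip)) s =
          (s.sets i l).sets j (some b :: s.gets j) := by
        cases b <;> simp [exec, hx, Mem.gets_sets, hij]
      rw [h1, ih]
      · simp only [Mem.gets_sets, hij, Ne.symm hij, if_true, if_false]
        cases s
        cases i <;> cases j <;> simp [Mem.sets] at hij ⊢
      · simp only [Mem.gets_sets, Ne.symm hij, if_true, if_false]
        rw [hx] at h
        exact fun h' => h (List.mem_cons_of_mem _ h')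
      · simp only [Mem.gets_sets, Ne.symm hij, if_true, if_false]
        rw [hx] at hl
        simpa using hl

/-- Multiply the binary number in `bin` by a counter. -/
def mul (r : Reg) : Cmd := loop (mulStep r) ⨾ moveBits .tmp .bin

/-- The result is padded to the fixed width `N ^ 30`, so the length of the number need not be known;
leading zeros are removed only on output. -/
theorem exec_mul {r : Reg} (hr : IsFactor r) {s : Mem} (hs : s.Clean)
    (hk : 2 * s.get r ≤ N ^ 30) (hl : s.bin.length ≤ N ^ 30)
    (hv : s.get r * binVal s.bin < 2 ^ N ^ 30) :
    exec N (mul r) s = { s with bin := binDigits (N ^ 30) (s.get r * binVal s.bin) } := by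
  obtain ⟨ht, -, -, -, -, -, hk0, hh, ho, htmp⟩ := hs
  rw [mul, exec, exec_loop, iterate_mulStep hr _ ht hh ho (by omega) hk hl (by simpa [hk0] using hv),
    exec_moveBits (by decide)]
  · cases s
    subst hk0 htmp
    simp [Mem.sets, Mem.gets]
  · simpa [Mem.gets, htmp, AllBits, hk0] using allBits_binDigits _ _
  · simp [Mem.gets, htmp, length_binDigits]

/-- Write the number in `bin` to the output. -/
def emit : Cmd :=
  push .out none ⨾ moveBits .bin .tmp ⨾ loop (ifs .tmp (· == some (some false)) (pop .tmp) skip) ⨾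
    moveBits .tmp .out

/-- The output is a stack, so the end marker is written first. On `tmp` the most significant digit
is on top, where superfluous zeros can be popped; the second move restores the order of the digits.
-/
theorem exec_emit {s : Mem} (h : AllBits s.bin) (hl : s.bin.length ≤ N ^ 30) (ht : s.tmp = []) :
    exec N emit s = { s with bin := [], out := stripZeros s.bin ++ none :: s.out } := by
  have h1 : ∀ (n : ℕ) (s : Mem), s.tmp.length ≤ n →
      (exec N (ifs .tmp (· == some (some false)) (pop .tmp) skip))^[n] s =
        { s with tmp := s.tmp.dropWhile (· == some false) } := by
    intro n
    induction n with
    | zero =>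
      intro s hs
      rw [List.length_eq_zero_iff.1 (Nat.le_zero.1 hs)]
      cases s
      obtain rfl := List.length_eq_zero_iff.1 (Nat.le_zero.1 hs)
      rfl
    | succ n ih =>
      intro s hs
      rcases hx : s.tmp with _ | ⟨x, l⟩
      · rw [Function.iterate_fixed]
        · cases s; subst hx; rfl
        · simp [exec, hx, Mem.gets]
      · by_cases hxf : x = some false
        · rw [Function.iterate_succ_apply]
          have : exec N (ifs .tmp (· == some (some false)) (pop .tmp) skip) s =
              { s with tmp := l } := by
            simp [exec, hx, Mem.gets, hxf, Mem.sets]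
          rw [this, ih { s with tmp := l } (by rw [hx] at hs; simpa using hs)]
          simp [hxf]
        · rw [Function.iterate_fixed]
          · cases s; subst hx; simp [hxf]
          · simp [exec, hx, Mem.gets, beq_eq_false_iff_ne.2 hxf]
  have h2 : AllBits (s.bin.reverse.dropWhile (· == some false)) := fun h' =>
    h (List.mem_reverse.1 ((List.dropWhile_sublist _).subset h'))
  have h3 : (s.bin.reverse.dropWhile (· == some false)).length ≤ N ^ 30 :=
    ((List.dropWhile_sublist _).length_le).trans (by simpa using hl)
  simp only [emit, exec]
  rw [exec_moveBits (i := .bin) (s := s.sets .out (none :: s.gets .out)) (by decide) h hl, exec_loop, h1 _ _ (by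
      simpa [Mem.gets, Mem.sets, ht] using hl),
    exec_moveBits (i := .tmp) (by decide) (by simpa [Mem.gets, Mem.sets, ht] using h2)
      (by simpa [Mem.gets, Mem.sets, ht] using h3)]
  cases s
  subst ht
  simp [Mem.gets, Mem.sets, stripZeros]

end Cmd

/-! ### Programs that write the periods of symbols and fillers. -/

/-- The factor of the period of a symbol that comes from the attributes, given the bits of the
symbol; the prime numbers after `c` are used. -/
def rowProd : ℕ → List Bool → ℕ
  | _, [] => 1
  | c, x :: l =>
    (bif x then nextPrime (nextPrime c) ^ 2 else nextPrime c) *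
      rowProd (nextPrime (nextPrime c)) l

/-- The prime number that is `2 * n` places after `c`. -/
def lastPrime (c n : ℕ) : ℕ := (fun c => nextPrime (nextPrime c))^[n] c

theorem lastPrime_succ (c n : ℕ) :
    lastPrime c (n + 1) = lastPrime (nextPrime (nextPrime c)) n := rfl

theorem le_lastPrime (c n : ℕ) : c ≤ lastPrime c n := by
  induction n generalizing c with
  | zero => exact le_rfl
  | succ n ih =>
    rw [lastPrime_succ]
    have := ih (nextPrime (nextPrime c))
    have := lt_nextPrime c
    have := lt_nextPrime (nextPrime c)
    omega

theorem rowProd_pos (c : ℕ) (l : List Bool) : 0 < rowProd c l := by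
  induction l generalizing c with
  | nil => simp [rowProd]
  | cons x l ih =>
    have h1 := (prime_nextPrime c).pos
    have h2 := (prime_nextPrime (nextPrime c)).pos
    rw [rowProd]
    refine Nat.mul_pos ?_ (ih _)
    cases x
    · exact h1
    · exact pow_pos h2 2

theorem rowProd_le (c : ℕ) (l : List Bool) :
    rowProd c l ≤ lastPrime c l.length ^ (2 * l.length) := by
  induction l generalizing c with
  | nil => simp [rowProd]
  | cons x l ih =>
    have h0 := (prime_nextPrime (nextPrime c)).pos
    have h1 := lt_nextPrime (nextPrime c)
    have h2 := le_lastPrime (nextPrime (nextPrime c)) l.length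
    rw [rowProd, List.length_cons, lastPrime_succ, mul_add, mul_one, pow_add, mul_comm]
    refine Nat.mul_le_mul (ih _) ?_
    cases x
    · simp only [cond_false]
      nlinarith
    · exact Nat.pow_le_pow_left h2 2

/-- The string of a list of periods. -/
def encodePeriods (l : List ℕ) : List (Option Bool) :=
  l.flatMap fun p => (Computability.encodeNat p).map some ++ [none]

theorem encodePeriods_append (l m : List ℕ) :
    encodePeriods (l ++ m) = encodePeriods l ++ encodePeriods m := List.flatMap_append

/-- The periods of the fillers for `n` attributes, for which the prime numbers after `c` are
used. -/
def fillers (d : ℕ) : ℕ → ℕ → List ℕ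
  | _, 0 => []
  | c, n + 1 =>
    let a := nextPrime c
    let b := nextPrime a
    fillers d b n ++ List.replicate ((b ^ 2 - 2) * (a - 1)) (d * a * b ^ 2)

namespace Cmd

variable {N : ℕ}

theorem exec_seq (P Q : Cmd) (s : Mem) : exec N (P ⨾ Q) s = exec N Q (exec N P s) := by
  rw [exec]

theorem exec_inc (r : Reg) (s : Mem) : exec N (inc r) s = s.set r (s.get r + 1) := by
  rw [exec]

theorem exec_dec (r : Reg) (s : Mem) : exec N (dec r) s = s.set r (s.get r - 1) := by
  rw [exec]

theorem exec_push (k : Str) (x : Option Bool) (s : Mem) :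
    exec N (push k x) s = s.sets k (x :: s.gets k) := by
  rw [exec]

theorem exec_pop (k : Str) (s : Mem) : exec N (pop k) s = s.sets k (s.gets k).tail := by
  rw [exec]

/-- Process an attribute of a symbol. -/
def rowStep : Cmd :=
  ifs .inp (· == some (some true))
    (pop .inp ⨾ toNextPrime ⨾ toNextPrime ⨾ mul .c ⨾ mul .c)
    (ifs .inp (· == some (some false)) (pop .inp ⨾ toNextPrime ⨾ mul .c ⨾ toNextPrime) skip)

theorem exec_mul_binDigits {r : Reg} (hr : IsFactor r) {s : Mem} (hs : s.Clean) {v : ℕ}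
    (hk : 2 * s.get r ≤ N ^ 30) (hb : s.bin = binDigits (N ^ 30) v)
    (hv : s.get r * v < 2 ^ N ^ 30) (hv' : v < 2 ^ N ^ 30) :
    exec N (mul r) s = { s with bin := binDigits (N ^ 30) (s.get r * v) } := by
  have : binVal s.bin = v := by rw [hb, binVal_binDigits hv']
  rw [exec_mul hr hs hk (by rw [hb, length_binDigits]) (by rwa [this]), this]

theorem exec_rowStep {x : Bool} {l : List (Option Bool)} {s : Mem} (hs : s.Clean) {v : ℕ}
    (hinp : s.inp = some x :: l) (hc : 1 ≤ s.c)
    (hN : 2 * nextPrime (nextPrime s.c) ≤ N ^ 30) (hb : s.bin = binDigits (N ^ 30) v)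
    (hv : v * (bif x then nextPrime (nextPrime s.c) ^ 2 else nextPrime s.c) < 2 ^ N ^ 30) :
    exec N rowStep s = { s with
      inp := l
      c := nextPrime (nextPrime s.c)
      bin := binDigits (N ^ 30)
        (v * (bif x then nextPrime (nextPrime s.c) ^ 2 else nextPrime s.c)) } := by
  have h1 := lt_nextPrime s.c
  have h2 := lt_nextPrime (nextPrime s.c)
  have hmul : ∀ (v a M : ℕ), 0 < a → v * a < M → v < M := fun v a M ha h =>
    (Nat.le_mul_of_pos_right v ha).trans_lt h
  cases x
  · simp only [cond_false] at hv ⊢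
    simp only [rowStep, exec, Mem.gets, hinp, List.head?_cons, Mem.sets, List.tail_cons]
    simp only [show (some (some false) == some (some true)) = false from rfl, cond_false,
      beq_self_eq_true, cond_true]
    rw [exec_toNextPrime (s := { s with inp := l }) hs hc (by simp; omega),
      exec_mul_binDigits (v := v) (.inl rfl) (by exact hs) (by simp [Mem.get]; omega)
        (by exact hb)
        (by simpa [Mem.get, mul_comm] using hv) (hmul _ _ _ (by omega) hv),
      exec_toNextPrime (by exact hs) (by simp; omega) (by simp; omega)]
    simp [Mem.get, mul_comm]
  · simp only [cond_true] at hv ⊢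
    simp only [rowStep, exec, Mem.gets, hinp, List.head?_cons, Mem.sets, List.tail_cons,
      beq_self_eq_true, cond_true]
    rw [pow_two, ← mul_assoc] at hv
    have hv2 := hmul _ _ _ (by omega) hv
    rw [exec_toNextPrime (s := { s with inp := l }) hs hc (by simp; omega),
      exec_toNextPrime (by exact hs) (by simp; omega) (by simp; omega)]
    dsimp only
    rw [exec_mul_binDigits (v := v)
        (s := { s with inp := l, c := nextPrime (nextPrime s.c) }) (.inl rfl) (by exact hs) (by simp [Mem.get]; omega)
        (by exact hb)
        (by simpa [Mem.get, mul_comm] using hv2) (hmul _ _ _ (by omega) hv2),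
      exec_mul_binDigits (.inl rfl) (by exact hs) (by simp [Mem.get]; omega) rfl
        (by simpa [Mem.get, mul_comm] using hv) (by simpa [Mem.get, mul_comm] using hv2)]
    simp only [Mem.get, Mem.mk.injEq, true_and, and_true]
    congr 1
    ring

theorem iterate_rowStep (l : List Bool) (n : ℕ) {s : Mem} (hn : l.length ≤ n) (hs : s.Clean)
    {v : ℕ} {r : List (Option Bool)} (hinp : s.inp = l.map some ++ none :: r) (hc : 1 ≤ s.c)
    (hN : 2 * lastPrime s.c l.length ≤ N ^ 30) (hb : s.bin = binDigits (N ^ 30) v)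
    (hv : v * rowProd s.c l < 2 ^ N ^ 30) :
    (exec N rowStep)^[n] s = { s with
      inp := none :: r
      c := lastPrime s.c l.length
      bin := binDigits (N ^ 30) (v * rowProd s.c l) } := by
  induction l generalizing n s v with
  | nil =>
    rw [Function.iterate_fixed]
    · cases s; subst hinp hb; simp [rowProd, lastPrime]
    · simp [rowStep, exec, Mem.gets, hinp]
  | cons x l ih =>
    obtain ⟨n, rfl⟩ : ∃ m, n = m + 1 := ⟨n - 1, by rw [List.length_cons] at hn; omega⟩
    rw [List.length_cons, lastPrime_succ] at hN
    have h1 := lt_nextPrime s.c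
    have h2 := lt_nextPrime (nextPrime s.c)
    have h3 := le_lastPrime (nextPrime (nextPrime s.c)) l.length
    rw [rowProd, ← mul_assoc] at hv
    rw [Function.iterate_succ_apply, exec_rowStep (v := v) (l := l.map some ++ none :: r) hs
      hinp hc (by omega) hb ((Nat.le_mul_of_pos_right _ (rowProd_pos _ _)).trans_lt hv)]
    rw [ih n (s := { s with
        inp := l.map some ++ none :: r
        c := nextPrime (nextPrime s.c)
        bin := binDigits (N ^ 30)
          (v * (bif x then nextPrime (nextPrime s.c) ^ 2 else nextPrime s.c)) })
      (by simpa using hn) hs rfl (by simp; omega) hN rfl hv]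
    simp [rowProd, lastPrime_succ, mul_assoc]

/-- Read a symbol and write its period. -/
def row : Cmd :=
  copy .d .c ⨾ inc .c ⨾ push .bin (some true) ⨾ mul .c ⨾ loop rowStep ⨾ pop .inp ⨾ emit ⨾ clear .c

theorem exec_row (l : List Bool) {s : Mem} (hs : s.Clean) (hc : s.c = 0) (hb : s.bin = [])
    (hl : l.length ≤ N ^ 30)
    {r : List (Option Bool)} (hinp : s.inp = l.map some ++ none :: r)
    (hN : 2 * lastPrime (s.d + 1) l.length ≤ N ^ 30)
    (hv : (s.d + 1) * rowProd (s.d + 1) l < 2 ^ N ^ 30) :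
    exec N row s = { s with
      inp := r
      out := (Computability.encodeNat ((s.d + 1) * rowProd (s.d + 1) l)).map some ++
        none :: s.out } := by
  have h3 := le_lastPrime (s.d + 1) l.length
  rw [row]
  simp only [exec_seq, exec_inc, exec_push, exec_pop]
  rw [exec_copy (by decide) (by decide) (by decide) (by simp [Mem.get]; omega) hs.1]
  simp only [Mem.set, Mem.get, Mem.sets, Mem.gets, hc, hb, zero_add]
  have h0 : s.d + 1 < 2 ^ N ^ 30 :=
    (Nat.le_mul_of_pos_right _ (rowProd_pos _ _)).trans_lt hv
  rw [exec_mul (s := { s with c := s.d + 1, bin := [some true] }) (.inl rfl) hs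
    (by simp [Mem.get]; omega) (by simp; omega) (by simpa [Mem.get, binVal] using h0)]
  have h1 : binVal [some true] = 1 := rfl
  simp only [Mem.get, h1, mul_one]
  rw [exec_loop, iterate_rowStep l _ (v := s.d + 1)
    (s := { s with c := s.d + 1, bin := binDigits (N ^ 30) (s.d + 1) }) hl hs hinp (by simp) hN
    rfl hv]
  simp only [List.tail_cons]
  generalize (s.d + 1) * rowProd (s.d + 1) l = v at *
  rw [exec_emit (s := { s with
      inp := r
      c := lastPrime (s.d + 1) l.length
      bin := binDigits (N ^ 30) v }) (allBits_binDigits _ _) (by simp [length_binDigits])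
      hs.2.2.2.2.2.2.2.2.2, exec_clear (by simp [Mem.get]; omega)]
  simp only [Mem.set, stripZeros_binDigits hv]

/-- Process all the symbols. -/
def rows : Cmd := loop (ifs .inp Option.isSome row skip)

/-- Each period is pushed in front of the earlier ones, whence the reversed order. -/
theorem exec_rows (ls : List (List Bool)) {s : Mem} (hs : s.Clean) (hc : s.c = 0)
    (hb : s.bin = []) (hls : ls.length ≤ N ^ 30) (hl : ∀ l ∈ ls, l.length = s.d)
    (hinp : s.inp = ls.flatMap fun l => l.map some ++ [none])
    (hN : ∀ l ∈ ls, 2 * lastPrime (s.d + 1) l.length ≤ N ^ 30)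
    (hv : ∀ l ∈ ls, (s.d + 1) * rowProd (s.d + 1) l < 2 ^ N ^ 30) :
    exec N rows s = { s with
      inp := []
      out := encodePeriods ((ls.map fun l => (s.d + 1) * rowProd (s.d + 1) l).reverse) ++
        s.out } := by
  rw [rows, exec_loop]
  -- Only the number of rounds is to vary in the induction; the `N ^ 30` of the size bounds stays
  -- fixed.
  generalize hn : N ^ 30 = n at hls
  clear hn
  induction ls generalizing n s with
  | nil =>
    rw [Function.iterate_fixed]
    · cases s; simp at hinp; subst hinp; simp [encodePeriods]
    · simp [exec, Mem.gets, hinp]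
  | cons l ls ih =>
    obtain ⟨n, rfl⟩ : ∃ m, n = m + 1 := ⟨n - 1, by rw [List.length_cons] at hls; omega⟩
    have hll := hl l (List.mem_cons_self ..)
    have hNl := hN l (List.mem_cons_self ..)
    have := le_lastPrime (s.d + 1) l.length
    have hinp' : s.inp = l.map some ++ none :: ls.flatMap fun l => l.map some ++ [none] := by
      rw [hinp]; simp
    have h1 : exec N (ifs .inp Option.isSome row skip) s = exec N row s := by
      simp only [exec, Mem.gets, hinp']
      cases l <;> rfl
    rw [Function.iterate_succ_apply, h1, exec_row l hs hc hb (by omega) hinp' hNl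
      (hv l (List.mem_cons_self ..))]
    rw [ih (s := { s with
        inp := ls.flatMap fun l => l.map some ++ [none]
        out := (Computability.encodeNat ((s.d + 1) * rowProd (s.d + 1) l)).map some ++
          none :: s.out }) hs hc hb (fun l' h => hl l' (List.mem_cons_of_mem _ h)) rfl
        (fun l' h => hN l' (List.mem_cons_of_mem _ h))
        (fun l' h => hv l' (List.mem_cons_of_mem _ h)) n (by simpa using hls)]
    simp [encodePeriods]

end Cmd

namespace Cmd

variable {N : ℕ}

/-- Write the period of a filler. -/
def filler : Cmd :=
  push .bin (some true) ⨾ mul .d ⨾ mul .a ⨾ mul .c ⨾ mul .c ⨾ emit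

theorem exec_filler {s : Mem} (hs : s.Clean) (hb : s.bin = []) (hd0 : 0 < s.d) (ha0 : 0 < s.a)
    (hc0 : 0 < s.c) (hd : 2 * s.d ≤ N ^ 30) (ha : 2 * s.a ≤ N ^ 30) (hc : 2 * s.c ≤ N ^ 30)
    (hv : s.d * s.a * s.c ^ 2 < 2 ^ N ^ 30) :
    exec N filler s = { s with out := encodePeriods [s.d * s.a * s.c ^ 2] ++ s.out } := by
  have e3 : s.c * (s.c * (s.a * s.d)) = s.d * s.a * s.c ^ 2 := by ring
  have h3 : s.c * (s.c * (s.a * s.d)) < 2 ^ N ^ 30 := by rwa [e3]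
  have h2 : s.c * (s.a * s.d) < 2 ^ N ^ 30 := (Nat.le_mul_of_pos_left _ hc0).trans_lt h3
  have h1 : s.a * s.d < 2 ^ N ^ 30 := (Nat.le_mul_of_pos_left _ hc0).trans_lt h2
  have h0 : s.d < 2 ^ N ^ 30 := (Nat.le_mul_of_pos_left _ ha0).trans_lt h1
  rw [filler]
  simp only [exec_seq, exec_push, Mem.sets, Mem.gets, hb]
  rw [exec_mul (s := { s with bin := [some true] }) (.inr (.inl rfl)) hs (by exact hd)
    (by simp; omega) (by simpa [binVal, Mem.get] using h0)]
  simp only [Mem.get, binVal, beq_self_eq_true, Bool.toNat_true, mul_zero, add_zero, mul_one]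
  rw [exec_mul_binDigits (s := { s with bin := binDigits (N ^ 30) s.d }) (v := s.d)
    (.inr (.inr rfl)) hs ha rfl h1 h0]
  simp only [Mem.get]
  rw [exec_mul_binDigits (s := { s with bin := binDigits (N ^ 30) (s.a * s.d) })
    (v := s.a * s.d) (.inl rfl) hs hc rfl h2 h1]
  simp only [Mem.get]
  rw [exec_mul_binDigits (s := { s with bin := binDigits (N ^ 30) (s.c * (s.a * s.d)) })
    (v := s.c * (s.a * s.d)) (.inl rfl) hs hc rfl h3 h2]
  simp only [Mem.get]
  rw [exec_emit (allBits_binDigits _ _) (by simp [length_binDigits])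
    (by exact hs.2.2.2.2.2.2.2.2.2), stripZeros_binDigits h3, e3]
  cases s
  subst hb
  simp [encodePeriods]

theorem iterate_filler {s : Mem} (hs : s.Clean) (hb : s.bin = []) (hd0 : 0 < s.d) (ha0 : 0 < s.a)
    (hc0 : 0 < s.c) (hd : 2 * s.d ≤ N ^ 30) (ha : 2 * s.a ≤ N ^ 30) (hc : 2 * s.c ≤ N ^ 30)
    (hv : s.d * s.a * s.c ^ 2 < 2 ^ N ^ 30) (n : ℕ) :
    (exec N filler)^[n] s =
      { s with out := encodePeriods (List.replicate n (s.d * s.a * s.c ^ 2)) ++ s.out } := by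
  induction n with
  | zero => rfl
  | succ n ih =>
    rw [Function.iterate_succ_apply', ih]
    rw [exec_filler
      (s := { s with
        out := encodePeriods (List.replicate n (s.d * s.a * s.c ^ 2)) ++ s.out }) hs hb hd0 ha0 hc0 hd ha hc hv]
    simp [List.replicate_succ, encodePeriods]

/-- Write the period of a filler as often as `x` says. -/
def fillerLoop : Cmd := copy .x .b ⨾ down .b filler

theorem iterate_fillerLoop {s : Mem} (hs : s.Clean) (hb : s.bin = []) (hd0 : 0 < s.d)
    (ha0 : 0 < s.a) (hc0 : 0 < s.c) (hd : 2 * s.d ≤ N ^ 30) (ha : 2 * s.a ≤ N ^ 30)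
    (hc : 2 * s.c ≤ N ^ 30) (hv : s.d * s.a * s.c ^ 2 < 2 ^ N ^ 30) (hx : s.x ≤ N ^ 30)
    (hb0 : s.b = 0) (n : ℕ) :
    (exec N fillerLoop)^[n] s =
      { s with
        out := encodePeriods (List.replicate (n * s.x) (s.d * s.a * s.c ^ 2)) ++ s.out } := by
  induction n with
  | zero => simp [encodePeriods]
  | succ n ih =>
    rw [Function.iterate_succ_apply', ih]
    rw [fillerLoop, exec_seq]
    rw [exec_copy
      (s := { s with
        out := encodePeriods (List.replicate (n * s.x) (s.d * s.a * s.c ^ 2)) ++ s.out })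
      (by decide) (by decide) (by decide) hx hs.1]
    simp only [Mem.set, Mem.get, hb0, zero_add]
    rw [exec_down (s := { s with
      b := s.x
      out := encodePeriods (List.replicate (n * s.x) (s.d * s.a * s.c ^ 2)) ++ s.out }) rfl hx]
    simp only [Mem.get]
    rw [iterate_filler (s := { s with
      b := s.x
      out := encodePeriods (List.replicate (n * s.x) (s.d * s.a * s.c ^ 2)) ++ s.out }) hs hb hd0 ha0 hc0 hd ha hc hv]
    cases s
    subst hb0
    simp only [Mem.set, Mem.mk.injEq, true_and, and_true]
    rw [← List.append_assoc, ← encodePeriods_append, ← List.replicate_add]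
    congr 3
    ring

/-- Write the periods of the fillers for an attribute. -/
def fillerStep : Cmd :=
  toNextPrime ⨾ copy .c .a ⨾ copy .c .x ⨾ dec .x ⨾ toNextPrime ⨾ copy .c .b ⨾
    down .b (copy .c .u) ⨾ dec .u ⨾ dec .u ⨾ down .u fillerLoop ⨾ clear .a ⨾ clear .x

theorem iterate_copy_c_u {s : Mem} (ht : s.t = 0) (hc : s.c ≤ N ^ 30) (n : ℕ) :
    (exec N (copy .c .u))^[n] s = { s with u := s.u + n * s.c } := by
  induction n with
  | zero => simp
  | succ n ih =>
    rw [Function.iterate_succ_apply', ih, exec_copy (s := { s with u := s.u + n * s.c }) (by decide) (by decide) (by decide) hc ht]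
    simp only [Mem.set, Mem.get, Mem.mk.injEq, true_and, and_true]
    ring

/-- With primes `p < q`, adding `q` to `u` a total of `q` times and decrementing twice gives `q ^ 2
- 2` outer rounds, each of which writes `p - 1` periods. The product of these numbers is never
stored in a counter, so only `q ^ 2` has to be bounded. -/
theorem exec_fillerStep {s : Mem} (hs : s.Clean) (hb : s.bin = []) (hd0 : 0 < s.d)
    (ha0 : s.a = 0) (hx0 : s.x = 0) (hb0 : s.b = 0) (hu0 : s.u = 0) (hc0 : 0 < s.c)
    (hd : 2 * s.d ≤ N ^ 30) (hc : nextPrime (nextPrime s.c) ^ 2 ≤ N ^ 30)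
    (hv : s.d * nextPrime s.c * nextPrime (nextPrime s.c) ^ 2 < 2 ^ N ^ 30) :
    exec N fillerStep s = { s with
      c := nextPrime (nextPrime s.c)
      out := encodePeriods (List.replicate
        ((nextPrime (nextPrime s.c) ^ 2 - 2) * (nextPrime s.c - 1))
        (s.d * nextPrime s.c * nextPrime (nextPrime s.c) ^ 2)) ++ s.out } := by
  have h1 := lt_nextPrime s.c
  have h2 := lt_nextPrime (nextPrime s.c)
  have h2b : 2 * nextPrime (nextPrime s.c) ≤ N ^ 30 :=
    le_trans (by have := (prime_nextPrime (nextPrime s.c)).two_le; nlinarith) hc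
  have ht := hs.1
  rw [fillerStep]
  simp only [exec_seq, exec_dec]
  rw [exec_toNextPrime hs hc0 (by omega)]
  generalize hp : nextPrime s.c = p at *
  rw [exec_copy (s := { s with c := p }) (by decide) (by decide) (by decide)
    (by simp [Mem.get]; omega) ht]
  simp only [Mem.set, Mem.get, ha0, zero_add]
  rw [exec_copy (s := { s with c := p, a := p }) (by decide) (by decide) (by decide)
    (by simp [Mem.get]; omega) ht]
  simp only [Mem.set, Mem.get, hx0, zero_add]
  rw [exec_toNextPrime (s := { s with c := p, a := p, x := p - 1 }) (by exact hs)
    (by simp; omega) (by simp; omega)]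
  dsimp only
  generalize hq : nextPrime p = q at *
  rw [exec_copy (s := { s with c := q, a := p, x := p - 1 }) (by decide) (by decide) (by decide)
    (by simp [Mem.get]; omega) ht]
  simp only [Mem.set, Mem.get, hb0, zero_add]
  rw [exec_down (s := { s with c := q, a := p, x := p - 1, b := q }) rfl
    (by simp [Mem.get]; omega)]
  simp only [Mem.get]
  rw [iterate_copy_c_u (s := { s with c := q, a := p, x := p - 1, b := q }) ht (by simp; omega)]
  simp only [Mem.set, hu0, zero_add]
  rw [exec_down (s := { s with c := q, a := p, x := p - 1, b := 0, u := q * q - 1 - 1 }) rfl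
    (by simp [Mem.get]; nlinarith)]
  simp only [Mem.get]
  rw [iterate_fillerLoop (s := { s with c := q, a := p, x := p - 1, b := 0, u := q * q - 1 - 1 })
    hs hb hd0 (by simp; omega) (by simp; omega) hd (by simp; omega) (by simp; omega) hv
    (by simp; omega) rfl]
  simp only [Mem.set]
  rw [exec_clear (x := .a) (by simp [Mem.get]; omega)]
  simp only [Mem.set]
  rw [exec_clear (x := .x) (by simp [Mem.get]; omega)]
  cases s
  subst ha0 hb0 hu0 hx0
  simp only [Mem.set, Mem.mk.injEq, true_and, and_true]
  rw [pow_two, Nat.sub_sub]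

theorem iterate_fillerStep (n : ℕ) {s : Mem} (hs : s.Clean) (hb : s.bin = []) (hd0 : 0 < s.d)
    (ha0 : s.a = 0) (hx0 : s.x = 0) (hb0 : s.b = 0) (hu0 : s.u = 0) (hc0 : 0 < s.c)
    (hd : 2 * s.d ≤ N ^ 30) (hc : lastPrime s.c n ^ 2 ≤ N ^ 30)
    (hv : s.d * lastPrime s.c n ^ 3 < 2 ^ N ^ 30) :
    (exec N fillerStep)^[n] s = { s with
      c := lastPrime s.c n
      out := encodePeriods (fillers s.d s.c n) ++ s.out } := by
  induction n generalizing s with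
  | zero => rfl
  | succ n ih =>
    rw [lastPrime_succ] at hc hv
    have h1 := lt_nextPrime s.c
    have h2 := lt_nextPrime (nextPrime s.c)
    have h3 := le_lastPrime (nextPrime (nextPrime s.c)) n
    rw [Function.iterate_succ_apply, exec_fillerStep hs hb hd0 ha0 hx0 hb0 hu0 hc0 hd
      ((Nat.pow_le_pow_left h3 2).trans hc) (lt_of_le_of_lt ?_ hv), ih (s := { s with
      c := nextPrime (nextPrime s.c)
      out := encodePeriods (List.replicate
        ((nextPrime (nextPrime s.c) ^ 2 - 2) * (nextPrime s.c - 1))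
        (s.d * nextPrime s.c * nextPrime (nextPrime s.c) ^ 2)) ++ s.out })
      hs hb hd0 ha0 hx0 hb0 hu0 (by simp; omega) hd hc hv]
    · simp [fillers, lastPrime_succ, encodePeriods_append]
    · rw [mul_assoc, pow_succ' _ 2]
      exact Nat.mul_le_mul_left _ (Nat.mul_le_mul (by omega) (Nat.pow_le_pow_left h3 2))

/-- Write the periods of all the fillers. -/
def allFillers : Cmd :=
  copy .d .c ⨾ inc .c ⨾ copy .d .w ⨾ down .w fillerStep ⨾ clear .c

theorem exec_allFillers {s : Mem} (hs : s.Clean) (hb : s.bin = [])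
    (ha0 : s.a = 0) (hx0 : s.x = 0) (hb0 : s.b = 0) (hu0 : s.u = 0) (hc0 : s.c = 0)
    (hw0 : s.w = 0)
    (hd : 2 * s.d ≤ N ^ 30) (hc : lastPrime (s.d + 1) s.d ^ 2 ≤ N ^ 30)
    (hv : s.d * lastPrime (s.d + 1) s.d ^ 3 < 2 ^ N ^ 30) :
    exec N allFillers s = { s with
      out := encodePeriods (fillers s.d (s.d + 1) s.d) ++ s.out } := by
  have ht := hs.1
  have h1 : lastPrime (s.d + 1) s.d ≤ N ^ 30 := le_trans (Nat.le_self_pow (by omega) _) hc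
  rw [allFillers]
  simp only [exec_seq, exec_inc]
  rw [exec_copy (by decide) (by decide) (by decide) (by simp [Mem.get]; omega) ht]
  simp only [Mem.set, Mem.get, hc0, zero_add]
  rw [exec_copy (s := { s with c := s.d + 1 }) (by decide) (by decide) (by decide)
    (by simp [Mem.get]; omega) ht]
  simp only [Mem.set, Mem.get, hw0, zero_add]
  rw [exec_down (s := { s with c := s.d + 1, w := s.d }) rfl (by simp [Mem.get]; omega)]
  simp only [Mem.get]
  rcases Nat.eq_zero_or_pos s.d with h | h
  · rw [h]
    simp only [Function.iterate_zero, id, Mem.set]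
    rw [exec_clear (x := .c) (by simp [Mem.get]; have := le_lastPrime (s.d + 1) s.d; omega)]
    cases s
    subst hc0 hw0 h
    simp [Mem.set, fillers, encodePeriods]
  · rw [iterate_fillerStep s.d (s := { s with c := s.d + 1, w := s.d }) hs hb h ha0 hx0 hb0 hu0
      (by simp) hd hc hv]
    simp only [Mem.set]
    rw [exec_clear (x := .c) h1]
    cases s
    subst hc0 hw0
    rfl

/-- Read the number of attributes. -/
def readNumber : Cmd := loop (ifs .inp (· == some (some true)) (pop .inp ⨾ inc .d) skip) ⨾ pop .inp

theorem exec_readNumber {d : ℕ} {r : List (Option Bool)} {s : Mem} (hd : d ≤ N ^ 30)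
    (hinp : s.inp = List.replicate d (some true) ++ none :: r) :
    exec N readNumber s = { s with inp := r, d := s.d + d } := by
  have h : ∀ (n d : ℕ) (s : Mem), d ≤ n → s.inp = List.replicate d (some true) ++ none :: r →
      (exec N (ifs .inp (· == some (some true)) (pop .inp ⨾ inc .d) skip))^[n] s =
        { s with inp := none :: r, d := s.d + d } := by
    intro n
    induction n with
    | zero =>
      intro d s hd hinp
      obtain rfl := Nat.le_zero.1 hd
      cases s
      subst hinp
      rfl
    | succ n ih =>
      intro d s hd hinp
      rcases d with _ | d
      · rw [Function.iterate_fixed]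
        · cases s; subst hinp; rfl
        · simp [exec, Mem.gets, hinp]
      · have h1 : exec N (ifs .inp (· == some (some true)) (pop .inp ⨾ inc .d) skip) s =
            { s with inp := List.replicate d (some true) ++ none :: r, d := s.d + 1 } := by
          simp [exec, Mem.gets, hinp, List.replicate_succ, Mem.sets, Mem.set, Mem.get]
        rw [Function.iterate_succ_apply, h1, ih d { s with
          inp := List.replicate d (some true) ++ none :: r, d := s.d + 1 } (by omega) rfl]
        simp only [Mem.mk.injEq, and_true]
        omega
  rw [readNumber]
  simp only [exec_seq, exec_pop]
  rw [exec_loop, h _ _ _ hd hinp]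
  rfl

/-- Put as many empty symbols before the symbols as there are attributes. -/
def addEmpty : Cmd :=
  copy .d .w ⨾ down .w (push .inp none ⨾ times .d .t (push .inp (some false)))

theorem exec_addEmpty {s : Mem} (ht : s.t = 0) (hw : s.w = 0) (hd : s.d ≤ N ^ 30) :
    exec N addEmpty s = { s with
      inp := ((List.replicate s.d (List.replicate s.d false)).flatMap
        fun l => l.map some ++ [none]) ++ s.inp } := by
  have h1 : ∀ (n : ℕ) (s : Mem), (exec N (push .inp (some false)))^[n] s =
      { s with inp := List.replicate n (some false) ++ s.inp } := by
    intro n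
    induction n with
    | zero => intro s; rfl
    | succ n ih =>
      intro s
      rw [Function.iterate_succ_apply', ih]
      rfl
  have h2 : ∀ (n : ℕ) (s : Mem), s.t = 0 → s.d ≤ N ^ 30 →
      (exec N (push .inp none ⨾ times .d .t (push .inp (some false))))^[n] s =
        { s with inp := ((List.replicate n (List.replicate s.d false)).flatMap
          fun l => l.map some ++ [none]) ++ s.inp } := by
    intro n
    induction n with
    | zero => intro s _ _; rfl
    | succ n ih =>
      intro s ht hd
      rw [Function.iterate_succ_apply', ih s ht hd]
      simp only [exec_seq, exec_push, Mem.sets, Mem.gets]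
      rw [exec_times (by decide) rfl rfl (by exact hd) (by exact ht), h1]
      simp [List.replicate_succ, Mem.get]
  rw [addEmpty]
  simp only [exec_seq]
  rw [exec_copy (by decide) (by decide) (by decide) hd ht]
  simp only [Mem.set, Mem.get, hw, zero_add]
  rw [exec_down rfl (by exact hd)]
  simp only [Mem.get]
  rw [h2 _ _ (by exact ht) (by exact hd)]
  cases s
  subst hw
  rfl

/-- The program of the reduction. -/
def reduction : Cmd := readNumber ⨾ addEmpty ⨾ rows ⨾ allFillers ⨾ clear .d

/-- The guard in `hc'` is needed for the instance with no attributes and no symbols: its input has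
length one, so `N ^ 30 = 1`, which is less than twice the starting value `d + 1`. No row is
processed then. -/
theorem exec_reduction {d : ℕ} (ls : List (List Bool)) (hls : ls.length + d ≤ N ^ 30)
    (hl : ∀ l ∈ ls, l.length = d) (hc : lastPrime (d + 1) d ^ 2 ≤ N ^ 30)
    (hc' : 0 < ls.length + d → 2 * lastPrime (d + 1) d ≤ N ^ 30)
    (hv : ∀ l : List Bool, l.length = d → (d + 1) * rowProd (d + 1) l < 2 ^ N ^ 30)
    (hv' : d * lastPrime (d + 1) d ^ 3 < 2 ^ N ^ 30) :
    exec N reduction (Mem.blank (List.replicate d (some true) ++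
        none :: ls.flatMap fun l => l.map some ++ [none]) []) =
      Mem.blank [] (encodePeriods (fillers d (d + 1) d ++
        ((List.replicate d (List.replicate d false) ++ ls).map
          fun l => (d + 1) * rowProd (d + 1) l).reverse)) := by
  have h0 := le_lastPrime (d + 1) d
  have hl' : ∀ l ∈ List.replicate d (List.replicate d false) ++ ls, l.length = d := by
    intro l h
    rcases List.mem_append.1 h with h | h
    · rw [List.eq_of_mem_replicate h, List.length_replicate]
    · exact hl l h
  have hclean : ∀ x y, (Mem.blank x y).Clean := fun x y =>
    ⟨rfl, rfl, rfl, rfl, rfl, rfl, rfl, rfl, rfl, rfl⟩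
  rw [reduction]
  simp only [exec_seq]
  rw [exec_readNumber (by omega) rfl, exec_addEmpty rfl rfl (by simp [Mem.blank]; omega)]
  simp only [Mem.blank, zero_add]
  rw [exec_rows (List.replicate d (List.replicate d false) ++ ls) (by exact hclean [] []) rfl rfl
    (by simp; omega) hl' (by simp) (fun l h => by
      rw [hl' l h]
      refine hc' ?_
      have := List.length_pos_of_mem h
      simp only [List.length_append, List.length_replicate] at this
      omega) (fun l h => hv l (hl' l h))]
  dsimp only
  rw [exec_allFillers (by exact hclean [] []) rfl rfl rfl rfl rfl rfl rfl (by simp; omega) hc hv']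
  dsimp only
  rw [exec_clear (by simp [Mem.get]; omega)]
  simp only [Mem.set, List.append_nil, encodePeriods_append]

end Cmd

/-! ### Bounds for the primes and the periods. -/

theorem primeCounting_le_self (n : ℕ) : Nat.primeCounting n ≤ n := by
  have h : Nat.primesLE n ⊆ Finset.Icc 1 n := fun p hp => by
    have := (Nat.prime_of_mem_primesLE hp).one_lt
    have := Nat.le_of_mem_primesLE hp
    exact Finset.mem_Icc.2 ⟨by omega, this⟩
  rw [← Nat.primesLE_card_eq_primeCounting]
  simpa using Finset.card_le_card h

theorem primeCounting_nextPrime_le (n : ℕ) :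
    Nat.primeCounting (nextPrime n) ≤ Nat.primeCounting n + 1 := by
  have h : Nat.primesLE (nextPrime n) ⊆ insert (nextPrime n) (Nat.primesLE n) := fun p hp => by
    have hp' := Nat.prime_of_mem_primesLE hp
    have := Nat.le_of_mem_primesLE hp
    rw [Finset.mem_insert, Nat.mem_primesLE]
    by_contra! h
    exact h.1 (le_antisymm this (nextPrime_le hp' (by by_contra! h'; exact h.2 h' hp')))
  rw [← Nat.primesLE_card_eq_primeCounting, ← Nat.primesLE_card_eq_primeCounting]
  exact (Finset.card_le_card h).trans (Finset.card_insert_le _ _)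

theorem primeCounting_lastPrime_le (c n : ℕ) :
    Nat.primeCounting (lastPrime c n) ≤ c + 2 * n := by
  induction n with
  | zero => exact primeCounting_le_self c
  | succ n ih =>
    rw [lastPrime, Function.iterate_succ_apply']
    have h1 := primeCounting_nextPrime_le (lastPrime c n)
    have h2 := primeCounting_nextPrime_le (nextPrime (lastPrime c n))
    rw [lastPrime] at h1 h2 ih
    omega

/-- Chebyshev's argument: `2 ^ n` is at most `n + 1` times the least common multiple of the numbers
up to `n`, to which each prime up to `n` contributes a power not exceeding `n`. -/
theorem two_pow_le_pow_primeCounting (n : ℕ) : 2 ^ n ≤ (n + 1) * n ^ Nat.primeCounting n := by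
  refine (Chebyshev.two_pow_le_mul_lcmUpto n).trans (Nat.mul_le_mul_left _ ?_)
  rw [Nat.lcmUpto_eq_prod_pow_log, ← Nat.primesLE_card_eq_primeCounting]
  refine Finset.prod_le_pow_card _ _ _ fun p hp => ?_
  have h1 := (Nat.prime_of_mem_primesLE hp).pos
  have h2 := Nat.le_of_mem_primesLE hp
  exact Nat.pow_log_le_self p (by omega)

/-- The primes that the reduction uses are polynomially bounded. -/
theorem lastPrime_le {d : ℕ} (hd : 1 ≤ d) : lastPrime (d + 1) d ≤ (d + 1) ^ 8 := by
  by_contra! h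
  -- If the bound failed, there would be at most `3 * d + 1` primes up to `(d + 1) ^ 8`. Comparing
  -- exponents of two then gives `(d + 1) ^ 8 ≤ 1 + 8 * d * (3 * d + 2)`, whereas the left side is
  -- at least `64 * (d + 1) ^ 2`.
  have h1 := (Nat.monotone_primeCounting h.le).trans (primeCounting_lastPrime_le (d + 1) d)
  have h2 := two_pow_le_pow_primeCounting ((d + 1) ^ 8)
  have h3 : 0 < (d + 1) ^ 8 := by positivity
  have h4 : d + 1 ≤ 2 ^ d := Nat.lt_two_pow_self
  have h5 : 2 ^ (d + 1) ^ 8 ≤ 2 ^ (1 + d * (8 * (3 * d + 2))) :=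
    calc 2 ^ (d + 1) ^ 8 ≤ ((d + 1) ^ 8 + 1) * ((d + 1) ^ 8) ^ (3 * d + 1) :=
          h2.trans (Nat.mul_le_mul_left _ (Nat.pow_le_pow_right h3 (by omega)))
      _ ≤ (2 * (d + 1) ^ 8) * ((d + 1) ^ 8) ^ (3 * d + 1) := Nat.mul_le_mul_right _ (by omega)
      _ = 2 * (d + 1) ^ (8 * (3 * d + 2)) := by rw [← pow_mul, mul_assoc, ← pow_add]; ring_nf
      _ ≤ 2 * (2 ^ d) ^ (8 * (3 * d + 2)) := Nat.mul_le_mul_left _ (Nat.pow_le_pow_left h4 _)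
      _ = 2 ^ (1 + d * (8 * (3 * d + 2))) := by rw [← pow_mul, pow_add, pow_one]
  have h6 := (Nat.pow_le_pow_iff_right (by norm_num)).1 h5
  have h7 : 2 ^ 6 ≤ (d + 1) ^ 6 := Nat.pow_le_pow_left (by omega) 6
  have h8 : (d + 1) ^ 8 = (d + 1) ^ 6 * (d + 1) ^ 2 := by rw [← pow_add]
  nlinarith [Nat.mul_le_mul_right ((d + 1) ^ 2) h7]

theorem rowPeriod_le {d : ℕ} (hd : 1 ≤ d) {l : List Bool} (hl : l.length = d) :
    (d + 1) * rowProd (d + 1) l ≤ (d + 1) ^ (16 * d + 1) := by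
  have h := rowProd_le (d + 1) l
  rw [hl] at h
  rw [pow_succ', pow_mul]
  refine Nat.mul_le_mul_left _ (h.trans ?_)
  rw [pow_mul]
  refine Nat.pow_le_pow_left ?_ _
  have := Nat.pow_le_pow_left (lastPrime_le hd) 2
  rwa [← pow_mul] at this

theorem mem_fillers_le {d c n p : ℕ} (hp : p ∈ fillers d c n) : p ≤ d * lastPrime c n ^ 3 := by
  induction n generalizing c with
  | zero => simp [fillers] at hp
  | succ n ih =>
    rw [lastPrime_succ]
    rcases List.mem_append.1 hp with h | h
    · exact ih h
    · rw [List.eq_of_mem_replicate h]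
      have h1 := lt_nextPrime (nextPrime c)
      have h2 := le_lastPrime (nextPrime (nextPrime c)) n
      rw [mul_assoc, pow_succ' _ 2]
      exact Nat.mul_le_mul_left _ (Nat.mul_le_mul (by omega) (Nat.pow_le_pow_left h2 2))

theorem pos_of_mem_fillers {d c n p : ℕ} (hd : 0 < d) (hp : p ∈ fillers d c n) : 0 < p := by
  induction n generalizing c with
  | zero => simp [fillers] at hp
  | succ n ih =>
    rcases List.mem_append.1 hp with h | h
    · exact ih h
    · rw [List.eq_of_mem_replicate h]
      have h1 := lt_nextPrime c
      have h2 := lt_nextPrime (nextPrime c)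
      have : 0 < nextPrime c := by omega
      have : 0 < nextPrime (nextPrime c) := by omega
      positivity

theorem length_symbolBits {d : ℕ} (s : Finset (Fin d)) : (symbolBits s).length = d := by
  simp [symbolBits]

/-! ### The reduction: size of the periods and polynomial time. -/

/-- The periods of the scheduling instance: the fillers and, in reverse order, one period for each
symbol and for each of `d` additional empty symbols. -/
def BPCInstance.periodList (I : BPCInstance) : List ℕ :=
  fillers I.d (I.d + 1) I.d ++
    ((List.replicate I.d (List.replicate I.d false) ++ I.symbols.map symbolBits).map
      fun l => (I.d + 1) * rowProd (I.d + 1) l).reverse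

theorem BPCInstance.periodList_pos (I : BPCInstance) : ∀ p ∈ I.periodList, 0 < p := by
  intro p hp
  rcases List.mem_append.1 hp with h | h
  · refine pos_of_mem_fillers (Nat.pos_of_ne_zero fun h0 => ?_) h
    rw [h0] at h
    simp [fillers] at h
  · obtain ⟨l, -, rfl⟩ := List.mem_map.1 (List.mem_reverse.1 h)
    exact Nat.mul_pos (by omega) (rowProd_pos _ _)

/-- The reduction of Binary Partial Coding to Windows Scheduling. -/
def BPCInstance.toWS (I : BPCInstance) : WSInstance where
  periods := I.periodList.map Nat.toPNat'

theorem BPCInstance.map_coe_periods_toWS (I : BPCInstance) :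
    I.toWS.periods.map (fun p : ℕ+ => (p : ℕ)) = I.periodList := by
  rw [BPCInstance.toWS, List.map_map]
  conv_rhs => rw [← List.map_id I.periodList]
  refine List.map_congr_left fun p hp => ?_
  simp only [Function.comp, id, Nat.toPNat'_coe, if_pos (I.periodList_pos p hp)]

theorem BPCInstance.encode_toWS (I : BPCInstance) :
    I.toWS.encode = encodePeriods I.periodList := by
  rw [← I.map_coe_periods_toWS, encodePeriods, List.flatMap_map, WSInstance.encode]

theorem BPCInstance.mem_periodList_le (I : BPCInstance) (hd : 1 ≤ I.d) {p : ℕ}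
    (hp : p ∈ I.periodList) : p ≤ (I.d + 1) ^ (25 * I.d) := by
  rcases List.mem_append.1 hp with h | h
  · refine (mem_fillers_le h).trans ?_
    calc I.d * lastPrime (I.d + 1) I.d ^ 3 ≤ (I.d + 1) * ((I.d + 1) ^ 8) ^ 3 :=
          Nat.mul_le_mul (by omega) (Nat.pow_le_pow_left (lastPrime_le hd) 3)
      _ = (I.d + 1) ^ 25 := by ring
      _ ≤ (I.d + 1) ^ (25 * I.d) := Nat.pow_le_pow_right (by omega) (by omega)
  · obtain ⟨l, hl, rfl⟩ := List.mem_map.1 (List.mem_reverse.1 h)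
    refine (rowPeriod_le hd ?_).trans (Nat.pow_le_pow_right (by omega) (by omega))
    rcases List.mem_append.1 hl with h | h
    · rw [List.eq_of_mem_replicate h, List.length_replicate]
    · obtain ⟨s, -, rfl⟩ := List.mem_map.1 h
      exact length_symbolBits s

theorem BPCInstance.mem_toWS_le (I : BPCInstance) {p : ℕ+} (hp : p ∈ I.toWS.periods) :
    (p : ℕ) ≤ (max 2 I.d) ^ (50 * I.d) := by
  have hp' : (p : ℕ) ∈ I.periodList := by
    rw [← I.map_coe_periods_toWS]
    exact List.mem_map_of_mem hp
  rcases Nat.eq_zero_or_pos I.d with h0 | h0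
  · rcases List.mem_append.1 hp' with h | h
    · rw [h0] at h
      simp [fillers] at h
    · obtain ⟨l, hl, he⟩ := List.mem_map.1 (List.mem_reverse.1 h)
      have : l = [] := by
        rcases List.mem_append.1 hl with h | h
        · rw [List.eq_of_mem_replicate h, h0, List.replicate_zero]
        · obtain ⟨s, -, rfl⟩ := List.mem_map.1 h
          exact List.eq_nil_of_length_eq_zero ((length_symbolBits s).trans h0)
      rw [← he, this, h0]
      simp [rowProd]
  · refine (I.mem_periodList_le h0 hp').trans ?_
    -- The exponent doubles from 25 to 50 because `d + 1` is replaced by the square of `max 2 d`.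
    -- Without attributes all periods are 1, the case treated above.
    rw [show (max 2 I.d) ^ (50 * I.d) = ((max 2 I.d) ^ 2) ^ (25 * I.d) by rw [← pow_mul]; ring_nf]
    refine Nat.pow_le_pow_left ?_ _
    have h1 : 2 ≤ max 2 I.d := le_max_left _ _
    have h2 : I.d ≤ max 2 I.d := le_max_right _ _
    nlinarith

theorem BPCInstance.length_encode (I : BPCInstance) :
    I.encode.length = (I.symbols.length + 1) * (I.d + 1) := by
  have : ∀ l : List (Finset (Fin I.d)),
      (l.flatMap fun s => (symbolBits s).map some ++ [(none : Option Bool)]).length =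
        l.length * (I.d + 1) := by
    intro l
    induction l with
    | nil => simp
    | cons s l ih =>
      rw [List.flatMap_cons, List.length_append, ih, List.length_append, List.length_map,
        length_symbolBits, List.length_singleton, List.length_cons]
      ring
  rw [BPCInstance.encode, List.length_append, List.length_cons, this, List.length_replicate]
  ring

theorem BPCInstance.exec_reduction_encode (I : BPCInstance) :
    Cmd.exec I.encode.length Cmd.reduction (Mem.blank I.encode []) =
      Mem.blank [] I.toWS.encode := by
  rw [I.encode_toWS]
  generalize hN : I.encode.length = N
  rw [I.length_encode] at hN
  have hle : I.d + 1 ≤ N := by rw [← hN]; exact Nat.le_mul_of_pos_left _ (by omega)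
  have hle' : I.symbols.length + I.d ≤ N ^ 30 := by
    refine le_trans ?_ (Nat.le_self_pow (by norm_num) N)
    rw [← hN]
    nlinarith [Nat.zero_le (I.symbols.length * I.d)]
  -- The input has at least `d + 1` symbols. The largest exponent needed is 25, from the fillers, so
  -- 30 nested loops are ample. Periods of symbols are exponentially large, and for them it is the
  -- number of digits that is bounded.
  have hpow : ∀ {k}, k ≤ 30 → (I.d + 1) ^ k ≤ N ^ 30 := fun {k} hk =>
    (Nat.pow_le_pow_right (by omega) hk).trans (Nat.pow_le_pow_left hle 30)
  have hlt : ∀ {v k : ℕ}, k ≤ 30 → v ≤ (I.d + 1) ^ k → v < 2 ^ N ^ 30 := fun hk hv =>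
    (hv.trans (hpow hk)).trans_lt Nat.lt_two_pow_self
  have hprod : ∀ l : List Bool, l.length = I.d →
      (I.d + 1) * rowProd (I.d + 1) l < 2 ^ N ^ 30 := by
    intro l hl
    rcases Nat.eq_zero_or_pos I.d with h0 | h0
    · have : l = [] := List.eq_nil_of_length_eq_zero (hl.trans h0)
      subst this
      exact hlt (k := 1) (by norm_num) (by simp [rowProd])
    · refine (rowPeriod_le h0 hl).trans_lt ?_
      have h1 : I.d + 1 < 2 ^ (I.d + 1) := Nat.lt_two_pow_self
      calc (I.d + 1) ^ (16 * I.d + 1) < (2 ^ (I.d + 1)) ^ (16 * I.d + 1) :=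
            Nat.pow_lt_pow_left h1 (by omega)
        _ = 2 ^ ((I.d + 1) * (16 * I.d + 1)) := (pow_mul _ _ _).symm
        _ ≤ 2 ^ N ^ 30 := Nat.pow_le_pow_right (by norm_num) (le_trans ?_ (hpow (k := 6) (by omega)))
      have h3 : 2 ^ 4 ≤ (I.d + 1) ^ 4 := Nat.pow_le_pow_left (by omega) 4
      have h4 : (I.d + 1) ^ 6 = (I.d + 1) ^ 4 * (I.d + 1) ^ 2 := by rw [← pow_add]
      nlinarith [Nat.mul_le_mul_right ((I.d + 1) ^ 2) h3]
  have henc : I.encode = List.replicate I.d (some true) ++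
      none :: (I.symbols.map symbolBits).flatMap fun l => l.map some ++ [none] := by
    rw [BPCInstance.encode, List.flatMap_map]
  rw [henc]
  refine Cmd.exec_reduction _ (by simpa using hle') ?_ ?_ ?_ hprod ?_
  · intro l hl
    obtain ⟨s, -, rfl⟩ := List.mem_map.1 hl
    exact length_symbolBits s
  · rcases Nat.eq_zero_or_pos I.d with h0 | h0
    · rw [h0]
      exact Nat.pos_of_ne_zero (pow_ne_zero _ (by omega))
    · refine le_trans (Nat.pow_le_pow_left (lastPrime_le h0) 2) ?_
      rw [← pow_mul]
      exact hpow (by norm_num)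
  · intro h
    rw [List.length_map] at h
    rcases Nat.eq_zero_or_pos I.d with h0 | h0
    · have : I.symbols.length + 1 ≤ N := by rw [← hN]; exact Nat.le_mul_of_pos_right _ (by omega)
      rw [h0]
      exact (show 2 * 1 ≤ N by omega).trans (Nat.le_self_pow (by norm_num) N)
    · refine le_trans (Nat.mul_le_mul (show 2 ≤ I.d + 1 by omega) (lastPrime_le h0)) ?_
      rw [← pow_succ']
      exact hpow (by norm_num)
  · rcases Nat.eq_zero_or_pos I.d with h0 | h0
    · rw [h0, zero_mul]
      positivity
    · refine hlt (k := 25) (by norm_num) ?_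
      calc I.d * lastPrime (I.d + 1) I.d ^ 3 ≤ (I.d + 1) * ((I.d + 1) ^ 8) ^ 3 :=
            Nat.mul_le_mul (by omega) (Nat.pow_le_pow_left (lastPrime_le h0) 3)
        _ = (I.d + 1) ^ 25 := by ring

theorem BPCInstance.polyTime_toWS : Nonempty (Turing.TM2ComputableInPolyTime
    BPCInstance.encode WSInstance.encode BPCInstance.toWS) :=
  Cmd.polyTime _ _ _ Cmd.reduction BPCInstance.exec_reduction_encode

/-! ### Schedules as systems of residues. -/

/-- From its first execution on, a job occupies a full residue class modulo its period. Two such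
classes meet exactly if the residues agree modulo the gcd of the periods. -/
theorem WSInstance.schedulable_iff_residues (W : WSInstance) :
    W.Schedulable ↔ ∃ a : Fin W.periods.length → ℕ, ∀ j k, j ≠ k →
      ¬ a j ≡ a k [MOD Nat.gcd (W.periods.get j) (W.periods.get k)] := by
  constructor
  · rintro ⟨σ, hσ⟩
    choose a _ ha using fun j => (hσ j).1
    have hadd : ∀ j m, σ (a j + m * (W.periods.get j : ℕ)) = some j := by
      intro j m
      induction m with
      | zero => simpa using ha j
      | succ m ih =>
        rw [Nat.succ_mul, ← add_assoc]
        exact ((hσ j).2 _ ih).1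
    have hmod : ∀ j t, a j ≤ t → t ≡ a j [MOD (W.periods.get j : ℕ)] → σ t = some j := by
      intro j t h1 h2
      obtain ⟨m, hm⟩ := (Nat.modEq_iff_dvd' h1).1 h2.symm
      rw [← hadd j m, mul_comm m, ← hm, Nat.add_sub_cancel' h1]
    refine ⟨a, fun j k hjk h => hjk ?_⟩
    obtain ⟨t, h1, h2⟩ := Nat.chineseRemainder' h
    have hj := (W.periods.get j).pos
    have hk := (W.periods.get k).pos
    generalize hp : (W.periods.get j : ℕ) = p at *
    generalize hq : (W.periods.get k : ℕ) = q at *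
    -- The common solution `t` may precede the first executions; adding this multiple of both
    -- periods moves it beyond them.
    have h3 : a j + a k ≤ p * q * (a j + a k) := Nat.le_mul_of_pos_left _ (Nat.mul_pos hj hk)
    have h4 := hmod j (t + p * q * (a j + a k)) (by omega) (by
      rw [hp]
      refine Nat.ModEq.trans ?_ h1
      rw [mul_assoc]
      exact (Nat.modEq_iff_dvd' (by omega)).2 (by simp) |>.symm)
    have h5 := hmod k (t + p * q * (a j + a k)) (by omega) (by
      rw [hq]
      refine Nat.ModEq.trans ?_ h2
      rw [mul_comm p, mul_assoc]
      exact (Nat.modEq_iff_dvd' (by omega)).2 (by simp) |>.symm)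
    exact Option.some.inj (h4.symm.trans h5)
  · rintro ⟨a, ha⟩
    classical
    have huniq : ∀ t j k, t ≡ a j [MOD (W.periods.get j : ℕ)] →
        t ≡ a k [MOD (W.periods.get k : ℕ)] → j = k := by
      intro t j k h1 h2
      by_contra h
      exact ha j k h ((h1.symm.of_dvd (Nat.gcd_dvd_left _ _)).trans
        (h2.of_dvd (Nat.gcd_dvd_right _ _)))
    -- A slot goes to the job whose class contains it, which is unique by `huniq`; the least
    -- representative of the class is an execution within the first period.
    let σ : ℕ → Option (Fin W.periods.length) := fun t =>
      if h : ∃ j, t ≡ a j [MOD (W.periods.get j : ℕ)] then some h.choose else none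
    have hσ : ∀ t j, σ t = some j ↔ t ≡ a j [MOD (W.periods.get j : ℕ)] := by
      intro t j
      constructor
      · intro h
        by_cases h' : ∃ j, t ≡ a j [MOD (W.periods.get j : ℕ)]
        · rw [show σ t = some h'.choose from dif_pos h'] at h
          rw [← Option.some.inj h]
          exact h'.choose_spec
        · rw [show σ t = none from dif_neg h'] at h
          exact absurd h (by simp)
      · intro h
        have h' : ∃ j, t ≡ a j [MOD (W.periods.get j : ℕ)] := ⟨j, h⟩
        rw [show σ t = some h'.choose from dif_pos h', huniq t _ j h'.choose_spec h]
    refine ⟨σ, fun j => ⟨⟨a j % (W.periods.get j : ℕ), Nat.mod_lt _ (W.periods.get j).pos,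
      (hσ _ _).2 (Nat.mod_modEq _ _)⟩, fun t ht => ?_⟩⟩
    rw [hσ] at ht
    refine ⟨(hσ _ _).2 (Nat.ModEq.trans (by simp [Nat.ModEq]) ht), fun s h1 h2 hs => ?_⟩
    rw [hσ] at hs
    have := (Nat.modEq_iff_dvd' h1.le).1 (ht.trans hs.symm)
    have := Nat.le_of_dvd (by omega) this
    omega

/-- A family with the same multiset of values is a reindexing. -/
theorem exists_equiv_of_map_univ_eq {J J' : Type*} [Fintype J] [Fintype J'] {f : J → ℕ}
    {g : J' → ℕ} (h : (Finset.univ.val.map f : Multiset ℕ) = Finset.univ.val.map g) :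
    ∃ e : J ≃ J', ∀ j, f j = g (e j) := by
  have hcard : ∀ c, Fintype.card {j // f j = c} = Fintype.card {j // g j = c} := by
    intro c
    have := congrArg (Multiset.count c) h
    rw [Multiset.count_map, Multiset.count_map] at this
    rw [Fintype.card_subtype, Fintype.card_subtype, Finset.card, Finset.card, Finset.filter_val,
      Finset.filter_val]
    simpa only [eq_comm] using this
  let e := Equiv.ofFiberEquiv fun c => Fintype.equivOfCardEq (hcard c)
  exact ⟨e, fun j => (Equiv.ofFiberEquiv_map _ j).symm⟩

/-- After splitting off the common factors, the remaining ones on the two sides have different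
indices and are coprime. -/
theorem gcd_prod_prod {K : Type*} [DecidableEq K] {V : K → ℕ}
    (hV : Pairwise fun k l => Nat.Coprime (V k) (V l)) (S T : Finset K) :
    Nat.gcd (∏ k ∈ S, V k) (∏ k ∈ T, V k) = ∏ k ∈ S ∩ T, V k := by
  have h1 : ∏ k ∈ S, V k = (∏ k ∈ S ∩ T, V k) * ∏ k ∈ S \ T, V k := by
    rw [mul_comm, ← Finset.prod_sdiff (Finset.inter_subset_left : S ∩ T ⊆ S),
      Finset.sdiff_inter_self_left]
  have h2 : ∏ k ∈ T, V k = (∏ k ∈ S ∩ T, V k) * ∏ k ∈ T \ S, V k := by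
    rw [mul_comm, ← Finset.prod_sdiff (Finset.inter_subset_right : S ∩ T ⊆ T),
      Finset.sdiff_inter_self_right]
  rw [h1, h2, Nat.gcd_mul_left]
  have : Nat.Coprime (∏ k ∈ S \ T, V k) (∏ k ∈ T \ S, V k) := by
    refine Nat.Coprime.prod_left fun k hk => Nat.Coprime.prod_right fun l hl => hV ?_
    rintro rfl
    exact (Finset.mem_sdiff.1 hk).2 (Finset.mem_sdiff.1 hl).1
  rw [this, mul_one]

theorem modEq_prod_iff {K : Type*} [DecidableEq K] {V : K → ℕ}
    (hV : Pairwise fun k l => Nat.Coprime (V k) (V l)) (S : Finset K) (x y : ℕ) :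
    x ≡ y [MOD ∏ k ∈ S, V k] ↔ ∀ k ∈ S, x ≡ y [MOD V k] := by
  induction S using Finset.induction_on with
  | empty => simp [Nat.modEq_one]
  | insert k S hk ih =>
    rw [Finset.prod_insert hk, ← Nat.modEq_and_modEq_iff_modEq_mul, ih, Finset.forall_mem_insert]
    refine Nat.Coprime.prod_right fun l hl => hV ?_
    rintro rfl
    exact hk hl

/-- If the periods are products of pairwise coprime moduli, then a schedule amounts to a choice of
residues for each job such that any two jobs have a common modulus with different residues. -/
theorem WSInstance.schedulable_iff {J K : Type*} [Fintype J] [DecidableEq K] {W : WSInstance}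
    {V : K → ℕ} {T : J → Finset K} (hV : Pairwise fun k l => Nat.Coprime (V k) (V l))
    (hpos : ∀ j, ∀ k ∈ T j, V k ≠ 0)
    (hW : (Finset.univ.val.map fun j => ∏ k ∈ T j, V k : Multiset ℕ) =
      (W.periods.map fun p : ℕ+ => (p : ℕ) : List ℕ)) :
    W.Schedulable ↔ ∃ x : J → K → ℕ, (∀ j, ∀ k ∈ T j, x j k < V k) ∧
      ∀ j l, j ≠ l → ∃ k ∈ T j ∩ T l, x j k ≠ x l k := by
  obtain ⟨e, he⟩ := exists_equiv_of_map_univ_eq (J' := Fin W.periods.length)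
    (g := fun j => (W.periods.get j : ℕ)) (hW.trans (by
      rw [Fin.univ_val_map, ← List.ofFn_get (W.periods.map _)]
      congr 1
      apply List.ext_getElem <;> simp))
  rw [W.schedulable_iff_residues]
  constructor
  · rintro ⟨a, ha⟩
    refine ⟨fun j k => a (e j) % V k,
      fun j k hk => Nat.mod_lt _ (Nat.pos_of_ne_zero (hpos j k hk)), fun j l hjl => ?_⟩
    have := ha (e j) (e l) (fun h => hjl (e.injective h))
    rw [← he, ← he, gcd_prod_prod hV, modEq_prod_iff hV] at this
    push Not at this
    exact this
  · rintro ⟨x, hx, hdis⟩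
    -- The coordinates of each job are assembled separately, so only moduli that occur in some job
    -- have to be nonzero. This admits the modulus `d` for `d = 0`.
    have hcrt : ∀ j, ∃ a : ℕ, ∀ k ∈ T j, a ≡ x j k [MOD V k] := fun j =>
      ⟨_, (Nat.chineseRemainderOfFinset (x j) V (T j) (hpos j)
        (fun k _ l _ h => hV h)).2⟩
    choose a ha using hcrt
    refine ⟨fun j => a (e.symm j), fun j l hjl h => ?_⟩
    have h1 := he (e.symm j)
    have h2 := he (e.symm l)
    rw [e.apply_symm_apply] at h1 h2
    rw [← h1, ← h2, gcd_prod_prod hV, modEq_prod_iff hV] at h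
    obtain ⟨k, hk, hne⟩ := hdis (e.symm j) (e.symm l) (fun h => hjl (e.symm.injective h))
    rw [Finset.mem_inter] at hk
    have h3 := ((ha _ k hk.1).symm.trans (h k (Finset.mem_inter.2 hk))).trans (ha _ k hk.2)
    exact hne (h3.eq_of_lt_of_lt (hx _ k hk.1) (hx _ k hk.2))

/-! ### The coprime moduli. -/

/-- The prime number that belongs to the absence of attribute `i`. -/
def lowPrime (c i : ℕ) : ℕ := nextPrime (lastPrime c i)

/-- The prime number that belongs to attribute `i`. -/
def highPrime (c i : ℕ) : ℕ := nextPrime (lowPrime c i)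

theorem highPrime_eq (c i : ℕ) : highPrime c i = lastPrime c (i + 1) := by
  rw [lastPrime, Function.iterate_succ_apply']
  rfl

theorem prime_lowPrime (c i : ℕ) : (lowPrime c i).Prime := prime_nextPrime _

theorem prime_highPrime (c i : ℕ) : (highPrime c i).Prime := prime_nextPrime _

theorem lowPrime_lt_highPrime (c i : ℕ) : lowPrime c i < highPrime c i := lt_nextPrime _

theorem lt_lowPrime (c i : ℕ) : c < lowPrime c i := (le_lastPrime c i).trans_lt (lt_nextPrime _)

theorem lastPrime_mono (c : ℕ) : Monotone (lastPrime c) := by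
  refine monotone_nat_of_le_succ fun n => ?_
  rw [← highPrime_eq]
  exact (lt_nextPrime _).le.trans (lowPrime_lt_highPrime c n).le

theorem highPrime_lt_lowPrime {c i j : ℕ} (h : i < j) : highPrime c i < lowPrime c j := by
  rw [highPrime_eq]
  exact (lastPrime_mono c h).trans_lt (lt_nextPrime _)

/-- The moduli of which the periods are composed: `d` for the fillers, `d + 1` for the symbols,
and two of them for each attribute. -/
inductive Modulus (d : ℕ)
  | filler
  | symbol
  | low (i : Fin d)
  | high (i : Fin d)
  deriving DecidableEq

namespace Modulus

variable {d : ℕ}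

/-- The value of a modulus. -/
def val : Modulus d → ℕ
  | filler => d
  | symbol => d + 1
  | low i => lowPrime (d + 1) i
  | high i => highPrime (d + 1) i ^ 2

theorem coprime_lowPrime {m : ℕ} (hm : 0 < m) (hm' : m ≤ d + 1) (i : ℕ) :
    Nat.Coprime m (lowPrime (d + 1) i) :=
  (Nat.coprime_of_lt_prime hm.ne' (hm'.trans_lt (lt_lowPrime _ i)) (prime_lowPrime _ i)).symm

theorem coprime_highPrime {m : ℕ} (hm : 0 < m) (hm' : m ≤ d + 1) (i : ℕ) :
    Nat.Coprime m (highPrime (d + 1) i ^ 2) :=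
  .pow_right 2 (Nat.coprime_of_lt_prime hm.ne'
    (hm'.trans_lt ((lt_lowPrime _ i).trans (lowPrime_lt_highPrime _ i))) (prime_highPrime _ i)).symm

theorem lowPrime_ne_highPrime (c i j : ℕ) : lowPrime c i ≠ highPrime c j := by
  rcases le_or_gt i j with h | h
  · rcases h.eq_or_lt with rfl | h
    · exact (lowPrime_lt_highPrime c i).ne
    · exact (((lowPrime_lt_highPrime c i).trans (highPrime_lt_lowPrime h)).trans
        (lowPrime_lt_highPrime c j)).ne
  · exact (highPrime_lt_lowPrime h).ne'

theorem lowPrime_injective (c : ℕ) : Function.Injective (lowPrime c) :=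
  StrictMono.injective fun i _ h => (lowPrime_lt_highPrime c i).trans (highPrime_lt_lowPrime h)

theorem highPrime_injective (c : ℕ) : Function.Injective (highPrime c) :=
  StrictMono.injective fun _ j h => (highPrime_lt_lowPrime h).trans (lowPrime_lt_highPrime c j)

/-- Consecutive numbers are coprime, and the primes are distinct and exceed `d + 1`. For `d = 0`
only the moduli 0 and 1 exist, which are coprime as well. -/
theorem coprime_val : Pairwise fun k l : Modulus d => Nat.Coprime k.val l.val := by
  have hd : ∀ i : Fin d, 0 < d := fun i => i.pos
  have hll : ∀ i j : Fin d, i ≠ j → Nat.Coprime (lowPrime (d + 1) i) (lowPrime (d + 1) j) :=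
    fun i j h => (Nat.coprime_primes (prime_lowPrime _ _) (prime_lowPrime _ _)).2
      fun h' => h (Fin.ext (lowPrime_injective _ h'))
  have hhh : ∀ i j : Fin d, i ≠ j →
      Nat.Coprime (highPrime (d + 1) i ^ 2) (highPrime (d + 1) j ^ 2) :=
    fun i j h => .pow 2 2 ((Nat.coprime_primes (prime_highPrime _ _) (prime_highPrime _ _)).2
      fun h' => h (Fin.ext (highPrime_injective _ h')))
  have hlh : ∀ i j : Fin d, Nat.Coprime (lowPrime (d + 1) i) (highPrime (d + 1) j ^ 2) :=
    fun i j => .pow_right 2 ((Nat.coprime_primes (prime_lowPrime _ _) (prime_highPrime _ _)).2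
      (lowPrime_ne_highPrime _ _ _))
  have hsf : Nat.Coprime (d + 1) d := by simp
  rintro (_ | _ | i | i) (_ | _ | j | j) h
  · exact absurd rfl h
  · exact hsf.symm
  · exact coprime_lowPrime (hd j) (by omega) _
  · exact coprime_highPrime (hd j) (by omega) _
  · exact hsf
  · exact absurd rfl h
  · exact coprime_lowPrime (by omega) le_rfl _
  · exact coprime_highPrime (by omega) le_rfl _
  · exact (coprime_lowPrime (hd i) (by omega) _).symm
  · exact (coprime_lowPrime (by omega) le_rfl _).symm
  · exact hll i j fun h' => h (by rw [h'])
  · exact hlh i j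
  · exact (coprime_highPrime (hd i) (by omega) _).symm
  · exact (coprime_highPrime (by omega) le_rfl _).symm
  · exact (hlh j i).symm
  · exact hhh i j fun h' => h (by rw [h'])

/-- The moduli of a filler. -/
def ofFiller (i : Fin d) : Finset (Modulus d) := {filler, low i, high i}

/-- The moduli of a symbol. -/
def ofSymbol (s : Finset (Fin d)) : Finset (Modulus d) :=
  insert symbol (Finset.univ.image fun i => if i ∈ s then high i else low i)

theorem prod_ofFiller (i : Fin d) :
    ∏ k ∈ ofFiller i, k.val = d * lowPrime (d + 1) i * highPrime (d + 1) i ^ 2 := by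
  rw [ofFiller, Finset.prod_insert (by simp), Finset.prod_insert (by simp),
    Finset.prod_singleton, ← mul_assoc]
  rfl

theorem prod_ofSymbol (s : Finset (Fin d)) : ∏ k ∈ ofSymbol s, k.val =
    (d + 1) * ∏ i : Fin d, if i ∈ s then highPrime (d + 1) i ^ 2 else lowPrime (d + 1) i := by
  rw [ofSymbol, Finset.prod_insert, Finset.prod_image]
  · congr 1
    refine Finset.prod_congr rfl fun i _ => ?_
    split <;> rfl
  · intro i _ j _ h
    dsimp only at h
    split at h <;> split at h <;> simp_all
  · simp only [Finset.mem_image, Finset.mem_univ, true_and, not_exists]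
    intro i
    split <;> simp

theorem mem_ofSymbol {s : Finset (Fin d)} {k : Modulus d} : k ∈ ofSymbol s ↔
    k = symbol ∨ (∃ i ∈ s, k = high i) ∨ ∃ i ∉ s, k = low i := by
  simp only [ofSymbol, Finset.mem_insert, Finset.mem_image, Finset.mem_univ, true_and]
  refine or_congr_right ⟨?_, ?_⟩
  · rintro ⟨i, rfl⟩
    by_cases h : i ∈ s
    · exact .inl ⟨i, h, if_pos h⟩
    · exact .inr ⟨i, h, if_neg h⟩
  · rintro (⟨i, h, rfl⟩ | ⟨i, h, rfl⟩)
    · exact ⟨i, if_pos h⟩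
    · exact ⟨i, if_neg h⟩

theorem mem_ofFiller {i : Fin d} {k : Modulus d} :
    k ∈ ofFiller i ↔ k = filler ∨ k = low i ∨ k = high i := by
  simp [ofFiller]

end Modulus

/-! ### The periods as products of moduli. -/

theorem rowProd_symbolBits {d : ℕ} (c : ℕ) (s : Finset (Fin d)) : rowProd c (symbolBits s) =
    ∏ i : Fin d, if i ∈ s then highPrime c i ^ 2 else lowPrime c i := by
  have h : ∀ (d c : ℕ) (f : Fin d → Bool), rowProd c (List.ofFn f) =
      ∏ i : Fin d, bif f i then highPrime c i ^ 2 else lowPrime c i := by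
    intro d
    induction d with
    | zero => intro c f; simp [rowProd]
    | succ d ih =>
      intro c f
      rw [List.ofFn_succ, rowProd, ih, Fin.prod_univ_succ]
      -- Attribute `i + 1` counted from `c` has, by definition, the same primes as attribute `i`
      -- counted two primes later.
      rfl
  rw [symbolBits, h]
  refine Finset.prod_congr rfl fun i _ => ?_
  by_cases hi : i ∈ s <;> simp [hi]

theorem coe_fillers (d c n : ℕ) : (fillers d c n : Multiset ℕ) =
    ∑ i : Fin n, ((highPrime c i ^ 2 - 2) * (lowPrime c i - 1)) •
      ({d * lowPrime c i * highPrime c i ^ 2} : Multiset ℕ) := by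
  induction n generalizing c with
  | zero => rfl
  | succ n ih =>
    rw [fillers, ← Multiset.coe_add, ih, Fin.sum_univ_succ, add_comm, Multiset.coe_replicate,
      ← Multiset.nsmul_singleton]
    rfl

/-- The jobs of the scheduling instance: the additional empty symbols, the symbols, and the
fillers. -/
abbrev BPCInstance.Job (I : BPCInstance) : Type :=
  (Fin I.d ⊕ Fin I.symbols.length) ⊕
    (Σ i : Fin I.d, Fin (highPrime (I.d + 1) i ^ 2 - 2) × Fin (lowPrime (I.d + 1) i - 1))

/-- The symbols, with the additional empty symbols. -/
def BPCInstance.row (I : BPCInstance) : Fin I.d ⊕ Fin I.symbols.length → Finset (Fin I.d) :=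
  Sum.elim (fun _ => ∅) I.symbols.get

/-- The moduli of a job. -/
def BPCInstance.moduli (I : BPCInstance) : I.Job → Finset (Modulus I.d) :=
  Sum.elim (fun r => Modulus.ofSymbol (I.row r)) (fun f => Modulus.ofFiller f.1)

theorem map_univ_val_eq_sum {J : Type*} [Fintype J] (f : J → ℕ) :
    (Finset.univ.val.map f : Multiset ℕ) = ∑ j, {f j} := by
  rw [← Multiset.sum_map_singleton (Multiset.map f _), Multiset.map_map]
  rfl

theorem symbolBits_empty (d : ℕ) : symbolBits (∅ : Finset (Fin d)) = List.replicate d false := by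
  simp [symbolBits, List.ofFn_const]

/-- The order in which the program writes the periods is irrelevant for scheduling, so multisets are
compared: both sides are sums over empty symbols, symbols and fillers. -/
theorem BPCInstance.map_prod_moduli (I : BPCInstance) :
    (Finset.univ.val.map fun j => ∏ k ∈ I.moduli j, k.val : Multiset ℕ) =
      (I.toWS.periods.map fun p : ℕ+ => (p : ℕ) : List ℕ) := by
  have hrow : ∀ s : Finset (Fin I.d), ∏ k ∈ Modulus.ofSymbol s, k.val =
      (I.d + 1) * rowProd (I.d + 1) (symbolBits s) := fun s => by
    rw [Modulus.prod_ofSymbol, rowProd_symbolBits]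
  rw [I.map_coe_periods_toWS, BPCInstance.periodList, ← Multiset.coe_add, Multiset.coe_reverse,
    coe_fillers, map_univ_val_eq_sum, Fintype.sum_sum_type, Fintype.sum_sum_type, add_comm]
  congr 1
  · rw [Fintype.sum_sigma]
    refine Finset.sum_congr rfl fun i _ => ?_
    simp only [BPCInstance.moduli, Sum.elim_inr, Modulus.prod_ofFiller, Finset.sum_const,
      Finset.card_univ, Fintype.card_prod, Fintype.card_fin]
  · rw [List.map_append, ← Multiset.coe_add]
    simp only [BPCInstance.moduli, BPCInstance.row, Sum.elim_inl, Sum.elim_inr, hrow]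
    congr 1
    · rw [symbolBits_empty, List.map_replicate, Multiset.coe_replicate]
      simp [Multiset.nsmul_singleton]
    · rw [← map_univ_val_eq_sum, Fin.univ_val_map, List.map_map]
      congr 1
      apply List.ext_getElem <;> simp

/-- A zero modulus in a job would make its period zero; thus positivity of the periods settles the
case `d = 0` too. -/
theorem BPCInstance.schedulable_toWS_iff (I : BPCInstance) :
    I.toWS.Schedulable ↔ ∃ x : I.Job → Modulus I.d → ℕ,
      (∀ j, ∀ k ∈ I.moduli j, x j k < k.val) ∧
      ∀ j l, j ≠ l → ∃ k ∈ I.moduli j ∩ I.moduli l, x j k ≠ x l k := by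
  refine WSInstance.schedulable_iff Modulus.coprime_val (fun j k hk hk0 => ?_) I.map_prod_moduli
  have h1 : ∏ k ∈ I.moduli j, k.val ∈
      (Finset.univ.val.map fun j => ∏ k ∈ I.moduli j, k.val : Multiset ℕ) :=
    Multiset.mem_map_of_mem _ (Finset.mem_univ_val j)
  rw [I.map_prod_moduli, I.map_coe_periods_toWS, Multiset.mem_coe] at h1
  exact (I.periodList_pos _ h1).ne' (Finset.prod_eq_zero hk hk0)

/-! ### From a code to a schedule. -/

theorem Bool.toNat_injective : Function.Injective Bool.toNat := by decide

/-- Only attributes common to two symbols are compared, so the partial codes can be extended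
arbitrarily, here by `false`. -/
theorem BPCInstance.feasible_iff (I : BPCInstance) :
    I.toPC.Feasible ↔ ∃ c : Fin I.symbols.length → Fin I.d → Bool, ∀ j k, j ≠ k →
      ∃ i ∈ I.symbols.get j ∩ I.symbols.get k, c j i ≠ c k i := by
  constructor
  · rintro ⟨c, hc, hdis⟩
    refine ⟨fun j i => if h : i ∈ I.symbols.get j then decide (c j ⟨i, h⟩ = 1) else false,
      fun j k hjk => ?_⟩
    obtain ⟨i, hj, hk, hne⟩ := hdis j k hjk
    refine ⟨i, Finset.mem_inter.2 ⟨hj, hk⟩, fun h => ?_⟩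
    have h1 : c j ⟨i, hj⟩ < 2 := hc j ⟨i, hj⟩
    have h2 : c k ⟨i, hk⟩ < 2 := hc k ⟨i, hk⟩
    have h3 : decide (c j ⟨i, hj⟩ = 1) = decide (c k ⟨i, hk⟩ = 1) :=
      (dif_pos hj).symm.trans (h.trans (dif_pos hk))
    rw [decide_eq_decide] at h3
    omega
  · rintro ⟨c, hc⟩
    refine ⟨fun j i => (c j i.1).toNat, fun j i => Bool.toNat_lt _, fun j k hjk => ?_⟩
    obtain ⟨i, hi, hne⟩ := hc j k hjk
    exact ⟨i, (Finset.mem_inter.1 hi).1, (Finset.mem_inter.1 hi).2,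
      fun h => hne (Bool.toNat_injective h)⟩

/-- The residues of the jobs, given binary codes of the symbols. -/
def BPCInstance.residue (I : BPCInstance) (c : Fin I.symbols.length → Fin I.d → Bool) :
    I.Job → Modulus I.d → ℕ
  | .inl (.inl k), .symbol => k
  | .inl (.inr _), .symbol => I.d
  | .inl (.inr j), .high i => (c j i).toNat
  | .inl _, _ => 0
  | .inr f, .filler => f.1
  | .inr f, .low _ => f.2.2 + 1
  | .inr f, .high _ => f.2.1 + 2
  | .inr _, .symbol => 0

open Modulus in
-- The shifts by 1 and 2 in the residues of the fillers keep them off the value 0 of absent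
-- attributes and off the bits of present ones. Modulo `d + 1`, the empty symbols get `0, …, d - 1`
-- and the original symbols all get `d`, so the latter are separated by their codes alone.
theorem BPCInstance.schedulable_of_feasible {I : BPCInstance} (h : I.toPC.Feasible) :
    I.toWS.Schedulable := by
  obtain ⟨c, hc⟩ := I.feasible_iff.1 h
  rw [I.schedulable_toWS_iff]
  have hrf : ∀ (r : Fin I.d ⊕ Fin I.symbols.length) f, ∃ k ∈ I.moduli (.inl r) ∩ I.moduli (.inr f),
      I.residue c (.inl r) k ≠ I.residue c (.inr f) k := by
    intro r f
    by_cases hf : f.1 ∈ I.row r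
    · refine ⟨high f.1, Finset.mem_inter.2 ⟨mem_ofSymbol.2 (.inr (.inl ⟨_, hf, rfl⟩)),
        mem_ofFiller.2 (.inr (.inr rfl))⟩, ?_⟩
      rcases r with k | j
      · simp [BPCInstance.row] at hf
      · have := Bool.toNat_lt (c j f.1)
        simp only [BPCInstance.residue]
        omega
    · refine ⟨low f.1, Finset.mem_inter.2 ⟨mem_ofSymbol.2 (.inr (.inr ⟨_, hf, rfl⟩)),
        mem_ofFiller.2 (.inr (.inl rfl))⟩, ?_⟩
      rcases r with k | j <;> simp [BPCInstance.residue]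
  have hmem : ∀ r, symbol ∈ I.moduli (.inl r) := fun r => mem_ofSymbol.2 (.inl rfl)
  refine ⟨I.residue c, ?_, ?_⟩
  · rintro ((k | j) | ⟨i, u, v⟩) m hm
    · rcases mem_ofSymbol.1 hm with rfl | ⟨i, hi, rfl⟩ | ⟨i, hi, rfl⟩
      · have := k.2
        simp only [BPCInstance.residue, Modulus.val]
        omega
      · exact pow_pos (prime_highPrime _ _).pos 2
      · exact (prime_lowPrime _ _).pos
    · rcases mem_ofSymbol.1 hm with rfl | ⟨i, hi, rfl⟩ | ⟨i, hi, rfl⟩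
      · exact Nat.lt_succ_self _
      · have h1 := Nat.pow_le_pow_left (prime_highPrime (I.d + 1) i).two_le 2
        have := Bool.toNat_lt (c j i)
        simp only [BPCInstance.residue, Modulus.val]
        omega
      · exact (prime_lowPrime _ _).pos
    · rcases mem_ofFiller.1 hm with rfl | rfl | rfl
      · exact i.2
      · have := v.2
        simp only [BPCInstance.residue, Modulus.val]
        omega
      · have := u.2
        simp only [BPCInstance.residue, Modulus.val]
        omega
  · rintro (r | f) (r' | f') hne
    · rcases r with k | j <;> rcases r' with k' | j'
      · refine ⟨symbol, Finset.mem_inter.2 ⟨hmem _, hmem _⟩, fun h => hne ?_⟩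
        rw [Fin.ext h]
      · exact ⟨symbol, Finset.mem_inter.2 ⟨hmem _, hmem _⟩, k.2.ne⟩
      · exact ⟨symbol, Finset.mem_inter.2 ⟨hmem _, hmem _⟩, k'.2.ne'⟩
      · obtain ⟨i, hi, h⟩ := hc j j' fun h => hne (by rw [h])
        rw [Finset.mem_inter] at hi
        exact ⟨high i, Finset.mem_inter.2 ⟨mem_ofSymbol.2 (.inr (.inl ⟨i, hi.1, rfl⟩)),
          mem_ofSymbol.2 (.inr (.inl ⟨i, hi.2, rfl⟩))⟩, fun h' => h (Bool.toNat_injective h')⟩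
    · exact hrf r f'
    · obtain ⟨k, hk, h⟩ := hrf r' f
      exact ⟨k, by rwa [Finset.inter_comm], h.symm⟩
    · obtain ⟨i, u, v⟩ := f
      obtain ⟨i', u', v'⟩ := f'
      by_cases hi : i = i'
      · subst hi
        by_cases hu : u = u'
        · refine ⟨low i, Finset.mem_inter.2 ⟨mem_ofFiller.2 (.inr (.inl rfl)),
            mem_ofFiller.2 (.inr (.inl rfl))⟩, fun h => hne ?_⟩
          obtain rfl := Fin.ext (Nat.succ_injective h)
          rw [hu]
        · exact ⟨high i, Finset.mem_inter.2 ⟨mem_ofFiller.2 (.inr (.inr rfl)),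
            mem_ofFiller.2 (.inr (.inr rfl))⟩, fun h => hu (Fin.ext (Nat.add_right_cancel h))⟩
      · exact ⟨filler, Finset.mem_inter.2 ⟨mem_ofFiller.2 (.inl rfl),
          mem_ofFiller.2 (.inl rfl)⟩, fun h => hi (Fin.ext h)⟩

/-! ### From a schedule to a code. -/

/-- If all but two rows and all but one column of a rectangle that is more than twice as high as
wide can be covered by a smaller rectangle, then this rectangle is at most two rows and one column
smaller. -/
theorem le_of_rectangle {q p a b : ℕ} (hp : 2 ≤ p) (hq : 2 * p < q) (ha : a ≤ q) (hb1 : 1 ≤ b)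
    (hb : b ≤ p) (h : (q - 2) * (p - 1) ≤ (q - a) * (p - b)) : a ≤ 2 ∧ b ≤ 1 := by
  obtain ⟨x, rfl⟩ := Nat.exists_eq_add_of_le ha
  obtain ⟨y, rfl⟩ := Nat.exists_eq_add_of_le hb
  rw [Nat.add_sub_cancel_left, Nat.add_sub_cancel_left] at h
  have h2 : b ≤ 1 := by
    -- Losing a second column costs more than two rows can regain: `(q - 2) * (p - 1) ≤ q * (p - 2)`
    -- would imply `q ≤ 2 * p - 2`.
    by_contra! hb2
    obtain ⟨q', hq'⟩ := Nat.exists_eq_add_of_le (show 2 ≤ a + x by omega)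
    have h3 : x * y ≤ (q' + 2) * y := Nat.mul_le_mul_right _ (by omega)
    have h4 : q' * (y + 1) ≤ (a + x - 2) * (b + y - 1) := Nat.mul_le_mul (by omega) (by omega)
    nlinarith
  refine ⟨?_, h2⟩
  by_contra! ha2
  obtain rfl : b = 1 := by omega
  rw [Nat.add_sub_cancel_left] at h
  have := Nat.le_of_mul_le_mul_right h (by omega)
  omega

/-- Turns residues into bits: comparison with one fixed element separates the elements of a set of
at most two. -/
theorem exists_eq_iff_ne_of_card_le_two {s : Finset ℕ} (h : s.card ≤ 2) :
    ∃ v, ∀ y ∈ s, ∀ z ∈ s, y ≠ z → ¬(y = v ↔ z = v) := by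
  rcases s.eq_empty_or_nonempty with rfl | ⟨v, hv⟩
  · exact ⟨0, by simp⟩
  · refine ⟨v, fun y hy z hz hyz hiff => ?_⟩
    have h1 : y ≠ v := fun h' => hyz (h'.trans (hiff.1 h').symm)
    have h2 : z ≠ v := fun h' => h1 (hiff.2 h')
    exact absurd (Finset.two_lt_card.2 ⟨y, hy, z, hz, v, hv, hyz, h1, h2⟩) (by omega)

open Modulus in
theorem BPCInstance.feasible_of_schedulable {I : BPCInstance} (h : I.toWS.Schedulable) :
    I.toPC.Feasible := by
  obtain ⟨x, hx, hdis⟩ := I.schedulable_toWS_iff.1 h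
  have hmem : ∀ r, symbol ∈ I.moduli (.inl r) := fun r => mem_ofSymbol.2 (.inl rfl)
  have hhigh : ∀ r, ∀ i ∈ I.row r, high i ∈ I.moduli (.inl r) := fun r i hi =>
    mem_ofSymbol.2 (.inr (.inl ⟨i, hi, rfl⟩))
  have hlow : ∀ r, ∀ i ∉ I.row r, low i ∈ I.moduli (.inl r) := fun r i hi =>
    mem_ofSymbol.2 (.inr (.inr ⟨i, hi, rfl⟩))
  have hp : ∀ i : Fin I.d, 2 < lowPrime (I.d + 1) i := fun i => by
    have := lt_lowPrime (I.d + 1) i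
    have := i.pos
    omega
  -- This is why the higher prime is squared: the inequality `p < q` alone would not give the factor
  -- two.
  have hq : ∀ i : Fin I.d, 2 * lowPrime (I.d + 1) i < highPrime (I.d + 1) i ^ 2 := fun i => by
    have := lowPrime_lt_highPrime (I.d + 1) i
    have := hp i
    nlinarith
  -- The fillers of an attribute lie in one class.
  have hclass : ∀ (i : Fin I.d)
      (f g : Fin (highPrime (I.d + 1) i ^ 2 - 2) × Fin (lowPrime (I.d + 1) i - 1)),
      x (.inr ⟨i, f⟩) filler = x (.inr ⟨i, g⟩) filler := by
    have hlt : ∀ i f, x (.inr ⟨i, f⟩) filler < I.d := fun i f =>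
      hx (.inr ⟨i, f⟩) filler (mem_ofFiller.2 (.inl rfl))
    have hne : ∀ i i' f f', i ≠ i' → x (.inr ⟨i, f⟩) filler ≠ x (.inr ⟨i', f'⟩) filler := by
      intro i i' f f' hi
      obtain ⟨k, hk, h⟩ := hdis (.inr ⟨i, f⟩) (.inr ⟨i', f'⟩) (by simp [hi])
      rw [Finset.mem_inter] at hk
      have h1 := mem_ofFiller.1 hk.1
      have h2 := mem_ofFiller.1 hk.2
      rcases h1 with rfl | rfl | rfl
      · exact h
      · simp [hi] at h2
      · simp [hi] at h2
    let f₀ : ∀ i : Fin I.d,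
        Fin (highPrime (I.d + 1) i ^ 2 - 2) × Fin (lowPrime (I.d + 1) i - 1) := fun i =>
      (⟨0, by have := hp i; have := hq i; omega⟩, ⟨0, by have := hp i; omega⟩)
    -- The representatives of the `d` attributes have distinct residues below `d` and hence all of
    -- them. A filler that deviates from its representative would collide with that of another
    -- attribute.
    let φ : Fin I.d → Fin I.d := fun i => ⟨x (.inr ⟨i, f₀ i⟩) filler, hlt _ _⟩
    have hφ : Function.Surjective φ := Finite.surjective_of_injective fun i i' hi => by
      by_contra h
      exact hne i i' (f₀ i) (f₀ i') h (congrArg Fin.val hi)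
    have key : ∀ i f, x (.inr ⟨i, f⟩) filler = x (.inr ⟨i, f₀ i⟩) filler := by
      intro i f
      obtain ⟨k, hk⟩ := hφ ⟨_, hlt i f⟩
      have hk' : x (.inr ⟨k, f₀ k⟩) filler = x (.inr ⟨i, f⟩) filler := congrArg Fin.val hk
      by_cases hki : k = i
      · rw [← hk', hki]
      · exact absurd hk' (hne _ _ _ _ hki)
    exact fun i f g => (key i f).trans (key i g).symm
  -- The symbols take at most two values at an attribute, and one value at its absence.
  have hcard : ∀ i,
      (((Finset.univ.filter fun r => i ∈ I.row r).image fun r => x (.inl r) (high i)).card ≤ 2) ∧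
      (((Finset.univ.filter fun r => i ∉ I.row r).image fun r => x (.inl r) (low i)).card ≤ 1) := by
    intro i
    generalize h𝒜 : (Finset.univ.filter fun r => i ∈ I.row r).image
      (fun r => x (.inl r) (high i)) = 𝒜
    generalize hℬ : (Finset.univ.filter fun r => i ∉ I.row r).image
      (fun r => x (.inl r) (low i)) = ℬ
    have hA : 𝒜 ⊆ Finset.range (highPrime (I.d + 1) i ^ 2) := by
      rw [← h𝒜]
      intro y hy
      obtain ⟨r, hr, rfl⟩ := Finset.mem_image.1 hy
      exact Finset.mem_range.2 (hx (.inl r) (high i) (hhigh r i (Finset.mem_filter.1 hr).2))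
    have hB : ℬ ⊆ Finset.range (lowPrime (I.d + 1) i) := by
      rw [← hℬ]
      intro y hy
      obtain ⟨r, hr, rfl⟩ := Finset.mem_image.1 hy
      exact Finset.mem_range.2 (hx (.inl r) (low i) (hlow r i (Finset.mem_filter.1 hr).2))
    -- An added empty symbol guarantees a row that lacks `i`, even if every original symbol contains
    -- it.
    have hB1 : 1 ≤ ℬ.card := by
      refine Finset.card_pos.2 ⟨x (.inl (.inl i)) (low i), ?_⟩
      rw [← hℬ]
      refine Finset.mem_image_of_mem _ (Finset.mem_filter.2 ⟨Finset.mem_univ _, ?_⟩)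
      simp [BPCInstance.row]
    have hrf : ∀ r f, ∃ k ∈ I.moduli (.inl r) ∩ I.moduli (.inr ⟨i, f⟩),
        x (.inl r) k ≠ x (.inr ⟨i, f⟩) k := fun r f => hdis _ _ (by simp)
    -- Pairs of residues of the fillers avoid `𝒜` and `ℬ`, because a row shares only one modulus
    -- with a filler of `i`; they are distinct, because these fillers agree modulo `d`.
    have hcount := Finset.card_le_card_of_injOn
      (s := (Finset.univ : Finset
        (Fin (highPrime (I.d + 1) i ^ 2 - 2) × Fin (lowPrime (I.d + 1) i - 1))))
      (t := (Finset.range (highPrime (I.d + 1) i ^ 2) \ 𝒜) ×ˢ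
        (Finset.range (lowPrime (I.d + 1) i) \ ℬ))
      (fun f => (x (.inr ⟨i, f⟩) (high i), x (.inr ⟨i, f⟩) (low i))) (by
        intro f _
        simp only [Finset.coe_product, Set.mem_prod, Finset.mem_coe, Finset.mem_sdiff,
          Finset.mem_range]
        refine ⟨⟨hx (.inr ⟨i, f⟩) (high i) (mem_ofFiller.2 (.inr (.inr rfl))), fun hy => ?_⟩,
          hx (.inr ⟨i, f⟩) (low i) (mem_ofFiller.2 (.inr (.inl rfl))), fun hy => ?_⟩
        · rw [← h𝒜] at hy
          obtain ⟨r, hr, he⟩ := Finset.mem_image.1 hy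
          have hr' := (Finset.mem_filter.1 hr).2
          obtain ⟨k, hk, h⟩ := hrf r f
          rw [Finset.mem_inter] at hk
          rcases mem_ofFiller.1 hk.2 with rfl | rfl | rfl
          · have := mem_ofSymbol.1 hk.1
            simp at this
          · have := mem_ofSymbol.1 hk.1
            simp [hr'] at this
          · exact h he
        · rw [← hℬ] at hy
          obtain ⟨r, hr, he⟩ := Finset.mem_image.1 hy
          have hr' := (Finset.mem_filter.1 hr).2
          obtain ⟨k, hk, h⟩ := hrf r f
          rw [Finset.mem_inter] at hk
          rcases mem_ofFiller.1 hk.2 with rfl | rfl | rfl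
          · have := mem_ofSymbol.1 hk.1
            simp at this
          · exact h he
          · have := mem_ofSymbol.1 hk.1
            simp [hr'] at this)
      (by
        intro f _ g _ hfg
        rw [Prod.mk.injEq] at hfg
        by_contra hne
        obtain ⟨k, hk, h⟩ := hdis (.inr ⟨i, f⟩) (.inr ⟨i, g⟩) (by simp [hne])
        rcases mem_ofFiller.1 (Finset.mem_inter.1 hk).1 with rfl | rfl | rfl
        · exact h (hclass i f g)
        · exact h hfg.2
        · exact h hfg.1)
    rw [Finset.card_univ, Fintype.card_prod, Fintype.card_fin, Fintype.card_fin,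
      Finset.card_product, Finset.card_sdiff_of_subset hA, Finset.card_sdiff_of_subset hB,
      Finset.card_range, Finset.card_range] at hcount
    exact le_of_rectangle (hp i).le (hq i) (by simpa using Finset.card_le_card hA) hB1
      (by simpa using Finset.card_le_card hB) hcount
  -- Rows that lack `i` all have the same residue modulo its lower prime, which therefore separates
  -- no two rows.
  have hrow : ∀ r r', r ≠ r' → x (.inl r) symbol ≠ x (.inl r') symbol ∨
      ∃ i ∈ I.row r ∩ I.row r', x (.inl r) (high i) ≠ x (.inl r') (high i) := by
    intro r r' hr
    obtain ⟨k, hk, h⟩ := hdis (.inl r) (.inl r') (by simpa using hr)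
    rw [Finset.mem_inter] at hk
    rcases mem_ofSymbol.1 hk.1 with rfl | ⟨i, hi, rfl⟩ | ⟨i, hi, rfl⟩
    · exact .inl h
    · have : i ∈ I.row r' := by simpa using mem_ofSymbol.1 hk.2
      exact .inr ⟨i, Finset.mem_inter.2 ⟨hi, this⟩, h⟩
    · have : i ∉ I.row r' := by simpa using mem_ofSymbol.1 hk.2
      exact absurd (Finset.card_le_one.1 (hcard i).2 _
        (Finset.mem_image_of_mem _ (Finset.mem_filter.2 ⟨Finset.mem_univ r, hi⟩)) _
        (Finset.mem_image_of_mem _ (Finset.mem_filter.2 ⟨Finset.mem_univ r', this⟩))) h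
  have hempty : ∀ k r, .inl k ≠ r → x (.inl (.inl k)) symbol ≠ x (.inl r) symbol := by
    intro k r hr
    rcases hrow _ _ hr with h | ⟨i, hi, -⟩
    · exact h
    · simp [BPCInstance.row] at hi
  -- The additional empty symbols occupy all classes but one.
  have hsame : ∀ j j', x (.inl (.inr j)) symbol = x (.inl (.inr j')) symbol := by
    intro j j'
    let E := Finset.univ.image fun k : Fin I.d => x (.inl (.inl k)) symbol
    have hE : E.card = I.d := by
      rw [Finset.card_image_of_injective, Finset.card_univ, Fintype.card_fin]
      intro k k' hk
      by_contra h
      exact hempty k (.inl k') (by simpa using h) hk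
    have hE' : E ⊆ Finset.range (I.d + 1) := by
      intro y hy
      obtain ⟨k, -, rfl⟩ := Finset.mem_image.1 hy
      exact Finset.mem_range.2 (hx _ symbol (hmem _))
    have hmem' : ∀ j, x (.inl (.inr j)) symbol ∈ Finset.range (I.d + 1) \ E := by
      intro j
      refine Finset.mem_sdiff.2 ⟨Finset.mem_range.2 (hx _ symbol (hmem _)), fun hy => ?_⟩
      obtain ⟨k, -, hk⟩ := Finset.mem_image.1 hy
      exact hempty k (.inr j) (by simp) hk
    refine Finset.card_le_one.1 ?_ _ (hmem' j) _ (hmem' j')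
    rw [Finset.card_sdiff_of_subset hE', Finset.card_range, hE]
    omega
  choose v hv using fun i => exists_eq_iff_ne_of_card_le_two (hcard i).1
  -- The bit tells whether the residue is the distinguished one of the at most two that occur at the
  -- attribute.
  refine I.feasible_iff.2 ⟨fun j i => decide (x (.inl (.inr j)) (high i) = v i),
    fun j j' hj => ?_⟩
  rcases hrow (.inr j) (.inr j') (by simpa using hj) with h | ⟨i, hi, h⟩
  · exact absurd (hsame j j') h
  · refine ⟨i, hi, ?_⟩
    rw [Finset.mem_inter] at hi
    rw [Ne, decide_eq_decide]
    exact hv i _ (Finset.mem_image_of_mem _ (Finset.mem_filter.2 ⟨Finset.mem_univ _, hi.1⟩)) _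
      (Finset.mem_image_of_mem _ (Finset.mem_filter.2 ⟨Finset.mem_univ _, hi.2⟩)) h

theorem mainTheorem5 :
    ∃ reduction : BPCInstance → WSInstance,
      Nonempty (Turing.TM2ComputableInPolyTime
        BPCInstance.encode WSInstance.encode reduction) ∧
      (∀ I : BPCInstance, I.toPC.Feasible ↔ (reduction I).Schedulable) ∧
      ∃ C : ℕ, ∀ I : BPCInstance, ∀ p : ℕ+, p ∈ (reduction I).periods →
        (p : ℕ) ≤ (max 2 I.d) ^ (C * I.d) :=
  ⟨BPCInstance.toWS, BPCInstance.polyTime_toWS,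
    fun _ => ⟨BPCInstance.schedulable_of_feasible, BPCInstance.feasible_of_schedulable⟩,
    50, fun I _ hp => I.mem_toWS_le hp⟩
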